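/- **Proposition 4.5** (separate action of the transfer matrix on the second SoV basis). *Setting.* Let $\mathsf N\in\mathbb Z_{\ge 0}$, $2s_n\in\mathbb Z_{\ge 0}$ and $\xi_n\in\mathbb C$ for $n=1,\dots,\mathsf N$, let $\eta\in\mathbb C$, and let $K$ be a complex $2\times2$ matrix with eigenvalues $\mathsf k_1,\mathsf k_2$ (with multiplicity), $\mathsf k_2\ne0$. Let $\mathcal H=\bigotimes_{n=1}^{\mathsf N}\mathbb C^{2s_n+1}$. On $\mathbb C^{2s_n+1}$ let $S_n^z=\operatorname{diag}(s_n,s_n-1,\dots,-s_n)$, let $S_n^+$ be the matrix whose only nonzero entries are the superdiagonal ones $x_n(j)=\sqrt{j(2s_n+1-j)}$, $j=1,\dots,2s_n$, and let $S_n^-=(S_n^+)^t$. Put $$\mathsf L_{0n}(\lambda)=\begin{pmatrix}\lambda+\eta(\tfrac12+S_n^z)&\eta S_n^-\\ \eta S_n^+&\lambda+\eta(\tfrac12-S_n^z)\end{pmatrix},\qquad \mathsf M_0^{(K)}(\lambda)=K_0\,\mathsf L_{0\mathsf N}(\lambda-\xi_{\mathsf N})\cdots \mathsf L_{01}(\lambda-\xi_1),$$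 where the index $0$ denotes an auxiliary space $\mathbb C^2$, and $\mathsf T^{(K)}(\lambda)=\operatorname{tr}_0\mathsf M_0^{(K)}(\lambda)\in\operatorname{End}(\mathcal H)$. For $l\ge1$ let $P^+_{1\dots l}$ be the symmetrizer of $(\mathbb C^2)^{\otimes l}$, with image $V^+_{1\dots l}$, and define the fused transfer matrices $$\mathsf T^{(K|l)}(\lambda)=\operatorname{tr}_{V^+_{1\dots l}}\big[P^+_{1\dots l}\,\mathsf M_1^{(K)}(\lambda+(l-1)\eta)\cdots\mathsf M_{l-1}^{(K)}(\lambda+\eta)\,\mathsf M_l^{(K)}(\lambda)\,P^+_{1\dots l}\big],\qquad \mathsf T^{(K|0)}(\lambda)=1 .$$ Write $\xi_n^-=\xi_n-\eta/2$, $\ \xi_n^{(k)}=\xi_n^-+(s_n-k)\eta$, and $$a(\lambda)=\prod_{n=1}^{\mathsf N}(\lambda-\xi_n^-+s_n\eta),\qquad d(\lambda)=\prod_{n=1}^{\mathsf N}(\lambda-\xi_n^--s_n\eta).$$ Assume that $d(\xi_n^{(k)})\neq0$ for all $n$ and all $k\in\{1,\dots,2s_n\}$. For a covector $\langle S|$ of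 $\mathcal H$ and integers $h_n\in\{0,\dots,2s_n\}$ set $$\langle h_1,\dots,h_{\mathsf N}|=\langle S|\prod_{n=1}^{\mathsf N}\frac{\mathsf k_2^{\,h_n-2s_n}\,\mathsf T^{(K|2s_n-h_n)}(\xi_n^{(2s_n)})}{\prod_{k=0}^{2s_n-(h_n+1)}d(\xi_n^{(2s_n-k)})}$$ (factors ordered by increasing $n$), and let $\langle h_1,\dots,h_{\mathsf N}|=0$ if some $h_n\notin\{0,\dots,2s_n\}$. *Statement.* For every covector $\langle S|$, all $h_m\in\{0,\dots,2s_m\}$ $(m=1,\dots,\mathsf N)$ and every $n\in\{1,\dots,\mathsf N\}$, $$\langle h_1,\dots,h_{\mathsf N}|\,\mathsf T^{(K)}(\xi_n^{(h_n)})=\mathsf k_1\,a(\xi_n^{(h_n)})\,\langle h_1,\dots,h_n+1,\dots,h_{\mathsf N}|+\mathsf k_2\,d(\xi_n^{(h_n)})\,\langle h_1,\dots,h_n-1,\dots,h_{\mathsf N}| .$$ -/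

import Mathlib

namespace SpinChain

/-- The operator on the tensor product of the spaces with bases `κ 0, …, κ (m-1)` (with its product
basis) that acts as `X` on the factor number `i` and trivially on the others: `1 ⊗ ⋯ ⊗ X ⊗ ⋯ ⊗ 1`.
The entries may be operators themselves (elements of a noncommutative ring `R`). -/
def onFactor {R : Type*} [Zero R] {m : ℕ} {κ : Fin m → Type*} [∀ j, DecidableEq (κ j)]
    (i : Fin m) (X : Matrix (κ i) (κ i) R) : Matrix (∀ j, κ j) (∀ j, κ j) R :=
  fun x y => if ∀ j, j ≠ i → x j = y j then X (x i) (y i) else 0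

/-- `S^z = diag(s, s-1, …, -s)`, where `d = 2s`. -/
noncomputable def spinZ (d : ℕ) : Matrix (Fin (d + 1)) (Fin (d + 1)) ℂ :=
  Matrix.diagonal fun i => (d : ℂ) / 2 - (i : ℕ)

/-- `S^+`, with superdiagonal entries `x(j) = √(j (2s + 1 - j))` for `j = 1, …, 2s`, where `d = 2s`
(`x(j)` stands in row `j - 1` and column `j`, rows and columns being numbered from `0`). -/
noncomputable def spinPlus (d : ℕ) : Matrix (Fin (d + 1)) (Fin (d + 1)) ℂ :=
  fun i j => if (i : ℕ) + 1 = j then ((Real.sqrt ((j : ℕ) * ((d : ℝ) + 1 - (j : ℕ))) : ℝ) : ℂ) else 0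

/-- `S^- = (S^+)^t`. -/
noncomputable def spinMinus (d : ℕ) : Matrix (Fin (d + 1)) (Fin (d + 1)) ℂ :=
  (spinPlus d).transpose

section Chain

variable {N : ℕ} (twoS : Fin N → ℕ)

/-- Labels of the product basis of the quantum space `𝓗 = ⊗ₙ ℂ^(2sₙ+1)`. -/
abbrev Config : Type := (n : Fin N) → Fin (twoS n + 1)

/-- Operators on `𝓗`. -/
abbrev QOp : Type := Matrix (Config twoS) (Config twoS) ℂ

/-- Covectors of `𝓗` (rows of components in the product basis); operators act on them from the
right by `Matrix.vecMul`. -/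
abbrev Covector : Type := Config twoS → ℂ

variable (η : ℂ) (ξ : Fin N → ℂ) (K : Matrix (Fin 2) (Fin 2) ℂ)

/-- The Lax operator `L_{0n}(u)`, a `2 × 2` matrix over the auxiliary space with entries in the
operators on `𝓗` that act on site `n` only. -/
noncomputable def lax (n : Fin N) (u : ℂ) : Matrix (Fin 2) (Fin 2) (QOp twoS) :=
  !![onFactor n (u • 1 + η • ((1 / 2 : ℂ) • 1 + spinZ (twoS n))),
       onFactor n (η • spinMinus (twoS n));
     onFactor n (η • spinPlus (twoS n)),
       onFactor n (u • 1 + η • ((1 / 2 : ℂ) • 1 - spinZ (twoS n)))]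

/-- The monodromy matrix `M₀(u) = K₀ L_{0N}(u - ξ_N) ⋯ L_{01}(u - ξ_1)`. -/
noncomputable def monodromy (u : ℂ) : Matrix (Fin 2) (Fin 2) (QOp twoS) :=
  K.map (algebraMap ℂ (QOp twoS)) *
    (List.ofFn fun n : Fin N => lax twoS η n (u - ξ n)).reverse.prod

/-- The transfer matrix `T(u) = tr₀ M₀(u)`. -/
noncomputable def transfer (u : ℂ) : QOp twoS :=
  (monodromy twoS η ξ K u).trace

/-- The permutation operator `P_π (v₁ ⊗ ⋯ ⊗ v_l) = v_{π(1)} ⊗ ⋯ ⊗ v_{π(l)}` on `(ℂ²)^{⊗ l}`, with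
entries seen as scalar operators on `𝓗`. -/
def permOperator {l : ℕ} (π : Equiv.Perm (Fin l)) :
    Matrix (Fin l → Fin 2) (Fin l → Fin 2) (QOp twoS) :=
  Matrix.of fun x y => if x = y ∘ π then 1 else 0

/-- The symmetrizer `P⁺ = (1/l!) ∑_π P_π` of `(ℂ²)^{⊗ l}`. -/
noncomputable def symmetrizer (l : ℕ) :
    Matrix (Fin l → Fin 2) (Fin l → Fin 2) (QOp twoS) :=
  ((l.factorial : ℂ)⁻¹) • ∑ π : Equiv.Perm (Fin l), permOperator twoS π

/-- The fused monodromy matrix `P⁺ M₁(u + (l-1)η) ⋯ M_{l-1}(u + η) M_l(u) P⁺`, as an operator on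
`(ℂ²)^{⊗ l} ⊗ 𝓗` (it vanishes on the complement of the image of `P⁺`). -/
noncomputable def fusedMonodromy (l : ℕ) (u : ℂ) :
    Matrix (Fin l → Fin 2) (Fin l → Fin 2) (QOp twoS) :=
  symmetrizer twoS l *
    (List.ofFn fun i : Fin l =>
      onFactor (κ := fun _ : Fin l => Fin 2) i
        (monodromy twoS η ξ K (u + ((l : ℂ) - 1 - (i : ℕ)) * η))).prod *
    symmetrizer twoS l

/-- The fused transfer matrix `T^{(l)}(u)`: the trace of the fused monodromy matrix over the image
of `P⁺`, which is its trace over `(ℂ²)^{⊗ l}`. For `l = 0` this is the identity. -/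
noncomputable def fusedTransfer (l : ℕ) (u : ℂ) : QOp twoS :=
  (fusedMonodromy twoS η ξ K l u).trace

/-- `a(u) = ∏ₙ (u - ξₙ⁻ + sₙ η)`, with `ξₙ⁻ = ξₙ - η/2`. -/
noncomputable def aFun (u : ℂ) : ℂ :=
  ∏ n : Fin N, (u - (ξ n - η / 2) + (twoS n : ℂ) / 2 * η)

/-- `d(u) = ∏ₙ (u - ξₙ⁻ - sₙ η)`, with `ξₙ⁻ = ξₙ - η/2`. -/
noncomputable def dFun (u : ℂ) : ℂ :=
  ∏ n : Fin N, (u - (ξ n - η / 2) - (twoS n : ℂ) / 2 * η)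

/-- The points `ξₙ^{(k)} = ξₙ⁻ + (sₙ - k) η`. -/
noncomputable def xiShift (n : Fin N) (k : ℤ) : ℂ :=
  (ξ n - η / 2) + ((twoS n : ℂ) / 2 - (k : ℂ)) * η

/-- The factor
`k₂^{h - 2sₙ} T^{(2sₙ - h)}(ξₙ^{(2sₙ)}) / ∏_{k=0}^{2sₙ-h-1} d(ξₙ^{(2sₙ-k)})` for `0 ≤ h ≤ 2sₙ`. -/
noncomputable def sovFactor (k₂ : ℂ) (n : Fin N) (h : ℤ) : QOp twoS :=
  (k₂ ^ (h - (twoS n : ℤ)) /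
      ∏ k ∈ Finset.range ((twoS n : ℤ) - h).toNat,
        dFun twoS η ξ (xiShift twoS η ξ n ((twoS n : ℤ) - (k : ℤ)))) •
    fusedTransfer twoS η ξ K ((twoS n : ℤ) - h).toNat (xiShift twoS η ξ n (twoS n))

open scoped Classical in
/-- The covector `⟨h₁, …, h_N| = ⟨S| ∏ₙ (factor n)` generated from `⟨S|` if `0 ≤ hₙ ≤ 2sₙ` for all
`n`, and zero if some `hₙ` is out of range. The factors of different sites commute; for
definiteness they are multiplied in the order `1, …, N`. -/
noncomputable def sovCovector (k₂ : ℂ) (S : Covector twoS) (h : Fin N → ℤ) : Covector twoS :=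
  if ∀ n, 0 ≤ h n ∧ h n ≤ twoS n then
    Matrix.vecMul S (List.ofFn fun n : Fin N => sovFactor twoS η ξ K k₂ n (h n)).prod
  else 0

end Chain

end SpinChain

open SpinChain

/-! The transfer matrices commute with one another and with all fused ones, so `T(ξₙ^{(hₙ)})` can be
moved next to the factor of site `n`, and the claim becomes an identity for that single factor.
Write `l = 2sₙ - hₙ` and `u = ξₙ^{(2sₙ)}`. Then `ξₙ^{(hₙ)} = u + lη`, and for `l ≥ 1` the fusion
relation reads `T(u + lη) T^{(l)}(u) = T^{(l+1)}(u) + det K · a(u + lη) d(u + (l-1)η) T^{(l-1)}(u)`.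
With the normalization of the factors and `det K = k₁ k₂`, its two terms are exactly the terms `hₙ -
1` and `hₙ + 1` (`truncFactor_mul_transfer`). At `l = 0` it is `T · 1 = T^{(1)}`; at `l = 2sₙ` the
truncation is justified by `T^{(2sₙ+1)}(ξₙ^{(2sₙ)}) = 0`.

Fusion is handled through generating polynomials. The column `j` of a `2 × 2` matrix becomes `A 0 j
+ A 1 j X`; in an ordered product of such columns, `X` only counts the row indices equal to `1`,
which projects the rows on symmetric tensors. If consecutive matrices are fusible, the product
depends on its columns only through their number of ones (`FusibleChain.colWord_eq`), so that the
trace over symmetric tensors is a sum over this number. Expanding along the first matrix gives the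
fusion relation (`FusibleChain.symTrace_eq`), and the quantum minor in it is scalar
(`qMinor_monodromy`).

The Lax operator is written with two bosons, its entries being `δ · scalar + η a_y† a_x`. Normal
ordering reduces the exchange relation, fusibility and the quantum determinant to linear identities.
At the points entering `T^{(2sₙ+1)}(ξₙ^{(2sₙ)})` the product of the columns of site `n` contains the
power `(a₀ + X a₁)^{2sₙ+1}`, which kills all states of `2sₙ` bosons (`prod_degenerateLax`). -/

namespace SpinChain

open Polynomial hiding funext

/-! ### Fusible pairs, column polynomials and the fusion recursion. -/

section Fusion

variable {R : Type*} [Ring R]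

/-- The quantum minor of rows `i`, `k` and columns `0`, `1` of a pair of matrices. -/
def qMinor (A B : Matrix (Fin 2) (Fin 2) R) (i k : Fin 2) : R :=
  A i 0 * B k 1 - A i 1 * B k 0

/-- The pair `(A, B)` can be fused: its quantum minors are antisymmetric in the rows. -/
structure Fusible (A B : Matrix (Fin 2) (Fin 2) R) : Prop where
  zero_zero : qMinor A B 0 0 = 0
  one_one : qMinor A B 1 1 = 0
  one_zero : qMinor A B 1 0 = -qMinor A B 0 1

/-- Cauchy–Binet: the minor expands over the two intermediate indices, and antisymmetry of the
minors of `A'`, `B'` kills the equal indices and merges the two remaining terms. This makes quantum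
determinants multiplicative along the chain. -/
theorem qMinor_mul {A A' B B' : Matrix (Fin 2) (Fin 2) R} (h' : Fusible A' B')
    (hc : ∀ i j k l, Commute (A' i j) (B k l)) (i k : Fin 2) :
    qMinor (A * A') (B * B') i k = qMinor A B i k * qMinor A' B' 0 1 := by
  have e : qMinor (A * A') (B * B') i k =
      A i 0 * B k 0 * qMinor A' B' 0 0 + A i 0 * B k 1 * qMinor A' B' 0 1 +
        A i 1 * B k 0 * qMinor A' B' 1 0 + A i 1 * B k 1 * qMinor A' B' 1 1 := by
    have hs : ∀ (a b b' : R) (i j k l : Fin 2),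
        (a * A' i j) * (B k l * b') = a * B k l * (A' i j * b') := fun a b b' i j k l => by
      rw [mul_assoc, ← mul_assoc (A' i j), (hc i j k l).eq]; simp only [mul_assoc]
    simp only [qMinor, Matrix.mul_apply, Fin.sum_univ_two, add_mul, mul_add, mul_sub]
    simp only [hs _ 0]
    abel
  rw [e, h'.zero_zero, h'.one_one, h'.one_zero]
  simp only [qMinor, mul_zero, sub_mul, mul_neg]
  abel

theorem Fusible.mul {A A' B B' : Matrix (Fin 2) (Fin 2) R} (h : Fusible A B) (h' : Fusible A' B')
    (hc : ∀ i j k l, Commute (A' i j) (B k l)) : Fusible (A * A') (B * B') where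
  zero_zero := by rw [qMinor_mul h' hc, h.zero_zero, zero_mul]
  one_one := by rw [qMinor_mul h' hc, h.one_one, zero_mul]
  one_zero := by rw [qMinor_mul h' hc, qMinor_mul h' hc, h.one_zero, neg_mul]

theorem fusible_one : Fusible (1 : Matrix (Fin 2) (Fin 2) R) 1 := by
  constructor <;> simp [qMinor]

/-- The generating polynomial of the column `j` of a matrix. -/
noncomputable def colPoly (A : Matrix (Fin 2) (Fin 2) R) (j : Fin 2) : R[X] :=
  C (A 0 j) + C (A 1 j) * X

/-- The coefficients of the difference of the two sides are the row-symmetric parts of the quantum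
minors, which vanish. In words of tensors: once the rows are symmetrized, the columns are symmetric
too. -/
theorem Fusible.colPoly_mul {A B : Matrix (Fin 2) (Fin 2) R} (h : Fusible A B) :
    colPoly A 0 * colPoly B 1 = colPoly A 1 * colPoly B 0 := by
  have e : colPoly A 0 * colPoly B 1 - colPoly A 1 * colPoly B 0 =
      C (qMinor A B 0 0) + C (qMinor A B 0 1 + qMinor A B 1 0) * X +
        C (qMinor A B 1 1) * X * X := by
    have hs : ∀ b : R, X * C b = C b * X := fun _ => X_mul
    simp only [qMinor, colPoly, map_sub, map_add, map_mul, add_mul, mul_add, sub_mul]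
    simp only [mul_assoc, hs]
    simp only [← mul_assoc]
    simp only [X_mul_C, mul_assoc]
    abel
  rw [h.zero_zero, h.one_one, h.one_zero] at e
  rw [← sub_eq_zero, e]
  simp

/-- The ordered product of the generating polynomials of the columns `y i` of the matrices `M i`. -/
noncomputable def colWord {l : ℕ} (M : Fin l → Matrix (Fin 2) (Fin 2) R) (y : Fin l → Fin 2) :
    R[X] :=
  (List.ofFn fun i => colPoly (M i) (y i)).prod

theorem colWord_succ {l : ℕ} (M : Fin (l + 1) → Matrix (Fin 2) (Fin 2) R)
    (y : Fin (l + 1) → Fin 2) :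
    colWord M y = colPoly (M 0) (y 0) * colWord (Fin.tail M) (Fin.tail y) := by
  simp [colWord, List.ofFn_succ, Fin.tail]

/-- Consecutive members of the family can be fused. -/
def FusibleChain {l : ℕ} (M : Fin l → Matrix (Fin 2) (Fin 2) R) : Prop :=
  ∀ i j : Fin l, (j : ℕ) = i + 1 → Fusible (M i) (M j)

theorem FusibleChain.tail {l : ℕ} {M : Fin (l + 1) → Matrix (Fin 2) (Fin 2) R}
    (h : FusibleChain M) : FusibleChain (Fin.tail M) :=
  fun i j hij => h i.succ j.succ (by simpa using hij)

/-- The sequence of `k` ones followed by zeros. -/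
def onesFirst (l k : ℕ) : Fin l → Fin 2 := fun i => if (i : ℕ) < k then 1 else 0

/-- The number of ones in a sequence. -/
def weight {l : ℕ} (x : Fin l → Fin 2) : ℕ := ∑ i, (x i : ℕ)

theorem weight_succ {l : ℕ} (x : Fin (l + 1) → Fin 2) :
    weight x = x 0 + weight (Fin.tail x) := by
  simp [weight, Fin.sum_univ_succ, Fin.tail]

theorem weight_le {l : ℕ} (x : Fin l → Fin 2) : weight x ≤ l := by
  calc weight x ≤ ∑ _i : Fin l, 1 := Finset.sum_le_sum fun i _ => by omega
    _ = l := by simp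

theorem tail_onesFirst_succ (l k : ℕ) :
    Fin.tail (onesFirst (l + 1) (k + 1)) = onesFirst l k := by
  ext i; simp [onesFirst, Fin.tail]

theorem tail_onesFirst_zero (l : ℕ) : Fin.tail (onesFirst (l + 1) 0) = onesFirst l 0 := by
  ext i; simp [onesFirst, Fin.tail]

theorem colWord_onesFirst_succ {l : ℕ} (M : Fin (l + 1) → Matrix (Fin 2) (Fin 2) R) (k : ℕ) :
    colWord M (onesFirst (l + 1) (k + 1)) =
      colPoly (M 0) 1 * colWord (Fin.tail M) (onesFirst l k) := by
  rw [colWord_succ, tail_onesFirst_succ]; simp [onesFirst]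

/-- A zero column is carried from behind the block of ones to the front, one exchange `10 ↔ 01` of
neighbours at a time. -/
theorem FusibleChain.colWord_onesFirst {l : ℕ} {M : Fin (l + 1) → Matrix (Fin 2) (Fin 2) R}
    (h : FusibleChain M) {k : ℕ} (hk : k ≤ l) :
    colWord M (onesFirst (l + 1) k) =
      colPoly (M 0) 0 * colWord (Fin.tail M) (onesFirst l k) := by
  induction l generalizing k with
  | zero => obtain rfl : k = 0 := by omega
            rw [colWord_succ, tail_onesFirst_zero]; simp [onesFirst]
  | succ l ih =>
    cases k with
    | zero => rw [colWord_succ, tail_onesFirst_zero]; simp [onesFirst]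
    | succ k =>
      rw [colWord_onesFirst_succ, colWord_onesFirst_succ, ih h.tail (by omega), ← mul_assoc,
        ← mul_assoc]
      congr 1
      exact (h 0 1 rfl).colPoly_mul.symm

theorem FusibleChain.colWord_eq {l : ℕ} {M : Fin l → Matrix (Fin 2) (Fin 2) R}
    (h : FusibleChain M) (y : Fin l → Fin 2) :
    colWord M y = colWord M (onesFirst l (weight y)) := by
  induction l with
  | zero => simp [colWord]
  | succ l ih =>
    rw [colWord_succ, ih h.tail, weight_succ]
    have h0 : y 0 = 0 ∨ y 0 = 1 := by omega
    rcases h0 with h0 | h0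
    · rw [h0, Fin.val_zero, zero_add, h.colWord_onesFirst (weight_le _)]
    · rw [h0, Fin.val_one, add_comm 1 (weight _), colWord_onesFirst_succ]

theorem coeff_colPoly_mul_succ (A : Matrix (Fin 2) (Fin 2) R) (j : Fin 2) (p : R[X]) (k : ℕ) :
    (colPoly A j * p).coeff (k + 1) = A 0 j * p.coeff (k + 1) + A 1 j * p.coeff k := by
  simp [colPoly, add_mul, mul_assoc]

theorem coeff_colPoly_mul_zero (A : Matrix (Fin 2) (Fin 2) R) (j : Fin 2) (p : R[X]) :
    (colPoly A j * p).coeff 0 = A 0 j * p.coeff 0 := by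
  simp [colPoly, add_mul, mul_assoc]

theorem coeff_colWord_eq_zero {l : ℕ} (M : Fin l → Matrix (Fin 2) (Fin 2) R) (y : Fin l → Fin 2)
    {k : ℕ} (hk : l < k) : (colWord M y).coeff k = 0 := by
  induction l generalizing k with
  | zero => simp [colWord, coeff_one, hk.ne']
  | succ l ih =>
    obtain ⟨k, rfl⟩ : ∃ m, k = m + 1 := ⟨k - 1, by omega⟩
    rw [colWord_succ, coeff_colPoly_mul_succ, ih _ _ (by omega), ih _ _ (by omega)]
    simp

/-- The trace of the product of the matrices `M i` over the symmetric tensors, in terms of the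
basis of symmetric tensors labelled by the number of ones. -/
noncomputable def symTrace {l : ℕ} (M : Fin l → Matrix (Fin 2) (Fin 2) R) : R :=
  ∑ k ∈ Finset.range (l + 1), (colWord M (onesFirst l k)).coeff k

theorem symTrace_zero (M : Fin 0 → Matrix (Fin 2) (Fin 2) R) : symTrace M = 1 := by
  simp [symTrace, colWord]

theorem symTrace_one (M : Fin 1 → Matrix (Fin 2) (Fin 2) R) :
    symTrace M = (M 0).trace := by
  simp [symTrace, Finset.sum_range_succ, colWord, onesFirst, colPoly, Matrix.trace, coeff_C]

/-- Expanding `symTrace M` along `M 0` gives the product of traces, except that `M 0 0 1 * (W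
k).coeff (k + 1)` stands in place of `M 0 0 0 * (W (k + 1)).coeff (k + 1)`. Expanding `W` along `M
1` turns this discrepancy into the quantum minor. -/
theorem FusibleChain.symTrace_eq {l : ℕ} {M : Fin (l + 2) → Matrix (Fin 2) (Fin 2) R}
    (h : FusibleChain M) :
    symTrace M = (M 0).trace * symTrace (Fin.tail M) -
      qMinor (M 0) (M 1) 0 1 * symTrace (Fin.tail (Fin.tail M)) := by
  set W : ℕ → R[X] := fun k => colWord (Fin.tail M) (onesFirst (l + 1) k) with hW
  set V : ℕ → R[X] := fun k => colWord (Fin.tail (Fin.tail M)) (onesFirst l k) with hV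
  -- A sequence with `k + 1` ones is read as starting with a one; only the sequence without ones
  -- starts with a zero.
  have h1 : symTrace M = M 0 0 0 * (W 0).coeff 0 +
      ∑ k ∈ Finset.range (l + 2),
        (M 0 0 1 * (W k).coeff (k + 1) + M 0 1 1 * (W k).coeff k) := by
    rw [symTrace, Finset.sum_range_succ', add_comm]
    congr 1
    · rw [h.colWord_onesFirst (Nat.zero_le _), coeff_colPoly_mul_zero]
    · refine Finset.sum_congr rfl fun k _ => ?_
      rw [colWord_onesFirst_succ, coeff_colPoly_mul_succ]
  have h2 : (M 0).trace * symTrace (Fin.tail M) =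
      M 0 0 0 * (W 0).coeff 0 + ∑ k ∈ Finset.range (l + 1), M 0 0 0 * (W (k + 1)).coeff (k + 1) +
        ∑ k ∈ Finset.range (l + 2), M 0 1 1 * (W k).coeff k := by
    rw [symTrace, Matrix.trace, Fin.sum_univ_two, add_mul, Finset.mul_sum, Finset.mul_sum,
      Finset.sum_range_succ', add_comm (M 0 0 0 * (W 0).coeff 0)]
    rfl
  have h3 : (W (l + 1)).coeff (l + 2) = 0 := coeff_colWord_eq_zero _ _ (by omega)
  -- This cancels the coefficients of degree `k + 1` of `V k` below.
  have hq : M 0 0 0 * M 1 0 1 = M 0 0 1 * M 1 0 0 := sub_eq_zero.mp (h 0 1 rfl).zero_zero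
  have h4 : qMinor (M 0) (M 1) 0 1 * symTrace (Fin.tail (Fin.tail M)) =
      ∑ k ∈ Finset.range (l + 1), (M 0 0 0 * (W (k + 1)).coeff (k + 1) -
        M 0 0 1 * (W k).coeff (k + 1)) := by
    rw [symTrace, Finset.mul_sum]
    refine Finset.sum_congr rfl fun k hk => ?_
    have hk : k ≤ l := by simpa [Nat.lt_succ_iff] using hk
    simp only [hW]
    rw [colWord_onesFirst_succ, h.tail.colWord_onesFirst hk, coeff_colPoly_mul_succ,
      coeff_colPoly_mul_succ]
    change (M 0 0 0 * M 1 1 1 - M 0 0 1 * M 1 1 0) * (V k).coeff k =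
      M 0 0 0 * (M 1 0 1 * (V k).coeff (k + 1) + M 1 1 1 * (V k).coeff k) -
        M 0 0 1 * (M 1 0 0 * (V k).coeff (k + 1) + M 1 1 0 * (V k).coeff k)
    simp only [mul_add, ← mul_assoc, hq, sub_mul]
    abel
  rw [h1, h2, h4, Finset.sum_add_distrib, Finset.sum_sub_distrib,
    Finset.sum_range_succ (fun k => M 0 0 1 * (W k).coeff (k + 1)), h3]
  simp only [mul_zero]
  abel

end Fusion

/-! ### Column words as sums over row sequences, and products of chains. -/

section Words

variable {R : Type*} [Ring R]

theorem prod_ofFn_sum {l : ℕ} (f : Fin l → Fin 2 → R) :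
    (List.ofFn fun i => ∑ b, f i b).prod =
      ∑ x : Fin l → Fin 2, (List.ofFn fun i => f i (x i)).prod := by
  induction l with
  | zero => simp
  | succ l ih =>
    rw [List.ofFn_succ, List.prod_cons, ih, Finset.sum_mul_sum, ← Fintype.sum_prod_type',
      ← (Fin.consEquiv fun _ => Fin 2).sum_comp]
    simp [Fin.consEquiv, List.ofFn_succ]

theorem commute_prod_ofFn {l : ℕ} (a : R) (g : Fin l → R) (h : ∀ i, Commute a (g i)) :
    Commute a (List.ofFn g).prod :=
  Commute.list_prod_right _ _ fun b hb => by
    obtain ⟨i, rfl⟩ := (List.mem_ofFn' _ _).mp hb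
    exact h i

theorem prod_ofFn_mul {l : ℕ} (f g : Fin l → R) (h : ∀ i j, Commute (g i) (f j)) :
    (List.ofFn fun i => f i * g i).prod = (List.ofFn f).prod * (List.ofFn g).prod := by
  induction l with
  | zero => simp
  | succ l ih =>
    simp only [List.ofFn_succ, List.prod_cons]
    rw [ih _ _ fun i j => h i.succ j.succ, mul_assoc, mul_assoc, ← mul_assoc (g 0),
      (commute_prod_ofFn (g 0) (fun i => f i.succ) fun i => h 0 i.succ).eq, mul_assoc]

/-- The entry `(x, y)` of the product of the matrices `M i` acting on different factors. -/
def entryWord {l : ℕ} (M : Fin l → Matrix (Fin 2) (Fin 2) R) (x y : Fin l → Fin 2) : R :=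
  (List.ofFn fun i => M i (x i) (y i)).prod

theorem prod_ofFn_X_pow {l : ℕ} (x : Fin l → Fin 2) :
    (List.ofFn fun i => (X : R[X]) ^ (x i : ℕ)).prod = X ^ weight x := by
  induction l with
  | zero => simp [weight]
  | succ l ih => rw [List.ofFn_succ, List.prod_cons, weight_succ, pow_add, ← ih]; rfl

theorem prod_ofFn_C {l : ℕ} (f : Fin l → R) :
    (List.ofFn fun i => C (f i)).prod = C (List.ofFn f).prod := by
  rw [map_list_prod, List.map_ofFn]; rfl

theorem colWord_eq_sum {l : ℕ} (M : Fin l → Matrix (Fin 2) (Fin 2) R) (y : Fin l → Fin 2) :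
    colWord M y = ∑ x, C (entryWord M x y) * X ^ weight x := by
  have h : ∀ i, colPoly (M i) (y i) = ∑ b : Fin 2, C (M i b (y i)) * X ^ (b : ℕ) := by
    simp [colPoly]
  simp only [colWord, h]
  rw [prod_ofFn_sum fun i b => C (M i b (y i)) * X ^ (b : ℕ)]
  refine Finset.sum_congr rfl fun x _ => ?_
  rw [prod_ofFn_mul (fun i => C (M i (x i) (y i))) (fun i => X ^ (x i : ℕ))
    fun i j => commute_X_pow _ _, prod_ofFn_X_pow, prod_ofFn_C, entryWord]

theorem coeff_colWord {l : ℕ} (M : Fin l → Matrix (Fin 2) (Fin 2) R) (y : Fin l → Fin 2) (k : ℕ) :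
    (colWord M y).coeff k = ∑ x, if weight x = k then entryWord M x y else 0 := by
  simp [colWord_eq_sum, coeff_X_pow, eq_comm]

theorem colWord_mul {l : ℕ} (A B : Fin l → Matrix (Fin 2) (Fin 2) R)
    (hc : ∀ i j a b c d, Commute (B i a b) (A j c d)) (y : Fin l → Fin 2) :
    colWord (fun i => A i * B i) y = ∑ z, colWord A z * C (entryWord B z y) := by
  have h : ∀ i, colPoly (A i * B i) (y i) =
      ∑ b : Fin 2, colPoly (A i) b * C (B i b (y i)) := fun i => by
    simp only [colPoly, Matrix.mul_apply, Fin.sum_univ_two, map_add, map_mul, add_mul, mul_assoc,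
      X_mul_C]
    abel
  simp only [colWord, h]
  rw [prod_ofFn_sum fun i b => colPoly (A i) b * C (B i b (y i))]
  refine Finset.sum_congr rfl fun x _ => ?_
  rw [prod_ofFn_mul (fun i => colPoly (A i) (x i)) (fun i => C (B i (x i) (y i))), prod_ofFn_C,
    entryWord]
  intro i j
  refine Commute.add_right ?_ (Commute.mul_right ?_ (commute_X _).symm)
  · exact (hc i j _ _ _ _).map C
  · exact (hc i j _ _ _ _).map C

/-- `colWord A z` depends only on the weight of `z`, so summing the entries of `B` over the
sequences `z` of a given weight produces a coefficient of `colWord B`. A fusible chain on the left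
thus preserves vanishing on symmetric tensors. -/
theorem FusibleChain.colWord_mul_eq_zero {l : ℕ} {A B : Fin l → Matrix (Fin 2) (Fin 2) R}
    (hA : FusibleChain A) (hc : ∀ i j a b c d, Commute (B i a b) (A j c d))
    (hB : ∀ y, colWord B y = 0) (y : Fin l → Fin 2) :
    colWord (fun i => A i * B i) y = 0 := by
  rw [colWord_mul A B hc]
  have h : ∀ z : Fin l → Fin 2, colWord A z * C (entryWord B z y) =
      ∑ k ∈ Finset.range (l + 1),
        colWord A (onesFirst l k) * C (if weight z = k then entryWord B z y else 0) := fun z => by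
    rw [Finset.sum_eq_single (weight z), hA.colWord_eq z, if_pos rfl]
    · intro k _ hk; rw [if_neg hk.symm]; simp
    · intro hz; exact absurd (Finset.mem_range.mpr (Nat.lt_succ_of_le (weight_le z))) hz
  simp_rw [h]
  rw [Finset.sum_comm]
  refine Finset.sum_eq_zero fun k _ => ?_
  rw [← Finset.mul_sum, ← map_sum, ← coeff_colWord, hB]
  simp

theorem colWord_mul_eq_zero_left {l : ℕ} {A B : Fin l → Matrix (Fin 2) (Fin 2) R}
    (hc : ∀ i j a b c d, Commute (B i a b) (A j c d))
    (hA : ∀ y, colWord A y = 0) (y : Fin l → Fin 2) :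
    colWord (fun i => A i * B i) y = 0 := by
  simp [colWord_mul A B hc, hA]

theorem symTrace_eq_zero {l : ℕ} {M : Fin l → Matrix (Fin 2) (Fin 2) R}
    (h : ∀ y, colWord M y = 0) : symTrace M = 0 := by
  simp [symTrace, h]

end Words

/-! ### Counting permutations: the symmetrizer in terms of weights. -/

section Permutations

theorem exists_comp_perm_of_weight_eq {l : ℕ} {x y : Fin l → Fin 2} (h : weight x = weight y) :
    ∃ σ : Equiv.Perm (Fin l), x = y ∘ σ := by
  have hw : ∀ z : Fin l → Fin 2, Fintype.card {i // z i = 1} = weight z := fun z => by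
    rw [Fintype.card_subtype, Finset.card_filter, weight]
    refine Finset.sum_congr rfl fun i _ => ?_
    have : z i = 0 ∨ z i = 1 := by omega
    rcases this with h | h <;> simp [h]
  have h1 : Fintype.card {i // x i = 1} = Fintype.card {i // y i = 1} := by rw [hw, hw, h]
  have h0 : ∀ z : Fin l → Fin 2, Fintype.card {i // z i = 0} = l - weight z := fun z => by
    have hc := Fintype.card_subtype_compl fun i => z i = 1
    rw [Fintype.card_fin, hw] at hc
    rw [← hc]
    exact Fintype.card_congr (Equiv.subtypeEquivRight fun i => by omega)
  have e : ∀ c : Fin 2, Nonempty ({i // x i = c} ≃ {i // y i = c}) := fun c => by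
    refine Fintype.card_eq.mp ?_
    have : c = 0 ∨ c = 1 := by omega
    rcases this with rfl | rfl
    · rw [h0, h0, h]
    · exact h1
  refine ⟨Equiv.ofFiberEquiv fun c => (e c).some, funext fun i => ?_⟩
  exact (Equiv.ofFiberEquiv_map _ i).symm

theorem weight_comp_perm {l : ℕ} (x : Fin l → Fin 2) (σ : Equiv.Perm (Fin l)) :
    weight (x ∘ σ) = weight x := by
  simp only [weight, Function.comp]
  exact Equiv.sum_comp σ fun i => (x i : ℕ)

/-- The number of permutations that carry `z` to `x`. -/
def permCount {l : ℕ} (x z : Fin l → Fin 2) : ℕ :=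
  (Finset.univ.filter fun π : Equiv.Perm (Fin l) => x = z ∘ π).card

theorem permCount_comp_left {l : ℕ} (x z : Fin l → Fin 2) (σ : Equiv.Perm (Fin l)) :
    permCount (x ∘ σ) z = permCount x z := by
  refine Finset.card_bij' (fun π _ => π * σ⁻¹) (fun π _ => π * σ) ?_ ?_ ?_ ?_
  · intro π hπ
    simp only [Finset.mem_filter, Finset.mem_univ, true_and] at hπ ⊢
    ext i
    have := congrFun hπ (σ⁻¹ i)
    simpa using congrArg Fin.val this
  · intro π hπ
    simp only [Finset.mem_filter, Finset.mem_univ, true_and] at hπ ⊢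
    rw [hπ]; rfl
  · simp
  · simp

theorem permCount_comp_right {l : ℕ} (x z : Fin l → Fin 2) (σ : Equiv.Perm (Fin l)) :
    permCount x (z ∘ σ) = permCount x z := by
  refine Finset.card_bij' (fun π _ => σ * π) (fun π _ => σ⁻¹ * π) ?_ ?_ ?_ ?_
  · intro π hπ
    simp only [Finset.mem_filter, Finset.mem_univ, true_and] at hπ ⊢
    rw [hπ]; rfl
  · intro π hπ
    simp only [Finset.mem_filter, Finset.mem_univ, true_and] at hπ ⊢
    rw [hπ]; ext i; simp
  · simp
  · simp

theorem permCount_eq_zero {l : ℕ} {x z : Fin l → Fin 2} (h : weight z ≠ weight x) :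
    permCount x z = 0 := by
  rw [permCount, Finset.card_eq_zero, Finset.filter_eq_empty_iff]
  rintro π - rfl
  exact h (weight_comp_perm z π).symm

theorem permCount_congr {l : ℕ} {x x' z z' : Fin l → Fin 2} (hx : weight x = weight x')
    (hz : weight z = weight z') : permCount x z = permCount x' z' := by
  obtain ⟨σ, rfl⟩ := exists_comp_perm_of_weight_eq hx
  obtain ⟨τ, rfl⟩ := exists_comp_perm_of_weight_eq hz
  rw [permCount_comp_left, permCount_comp_right]

theorem sum_permCount {l : ℕ} (z : Fin l → Fin 2) :
    ∑ x, permCount x z = l.factorial := by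
  simp only [permCount, Finset.card_filter]
  rw [Finset.sum_comm]
  simp [Fintype.card_perm]

theorem weight_onesFirst {l k : ℕ} (hk : k ≤ l) : weight (onesFirst l k) = k := by
  have : ∀ i : Fin l, ((onesFirst l k i : Fin 2) : ℕ) = if (i : ℕ) < k then 1 else 0 := fun i => by
    simp only [onesFirst]; split_ifs <;> rfl
  simp only [weight, this]
  rw [Fin.sum_univ_eq_sum_range fun i => if i < k then 1 else 0, Finset.sum_ite]
  have : (Finset.range l).filter (· < k) = Finset.range k := by
    ext i; simp; omega
  simp [this]

variable {R : Type*} [Ring R]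

/-- For fixed `x`, `permCount x z` is constant on the `z` of the weight of `x` and zero elsewhere,
so the inner sum is a coefficient of `colWord M x`, which depends on the weight only. The sum over
`x` then counts every permutation once. -/
theorem FusibleChain.sum_permCount_nsmul {l : ℕ} {M : Fin l → Matrix (Fin 2) (Fin 2) R}
    (h : FusibleChain M) :
    ∑ x, ∑ z, permCount x z • entryWord M z x = l.factorial • symTrace M := by
  have h1 : ∀ x : Fin l → Fin 2, ∑ z, permCount x z • entryWord M z x =
      ∑ k ∈ Finset.range (l + 1),
        permCount x (onesFirst l k) • (colWord M (onesFirst l k)).coeff k := fun x => by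
    have hx := weight_le x
    rw [Finset.sum_eq_single (weight x), ← h.colWord_eq x, coeff_colWord, Finset.smul_sum]
    · refine Finset.sum_congr rfl fun z _ => ?_
      split_ifs with hz
      · rw [permCount_congr rfl (hz.trans (weight_onesFirst hx).symm)]
      · rw [permCount_eq_zero hz]; simp
    · intro k hk hkx
      rw [permCount_eq_zero, zero_smul]
      rwa [weight_onesFirst (Nat.lt_succ_iff.mp (Finset.mem_range.mp hk))]
    · intro hx'
      exact absurd (Finset.mem_range.mpr (Nat.lt_succ_of_le hx)) hx'
  simp_rw [h1]
  rw [Finset.sum_comm, symTrace, Finset.smul_sum]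
  refine Finset.sum_congr rfl fun k _ => ?_
  rw [← Finset.sum_smul, sum_permCount]

end Permutations

/-! ### Ordered products of operators on different tensor factors. -/

section Factors

variable {R : Type*} [Ring R]

theorem sum_fin_succ_arrow {l : ℕ} (f : (Fin (l + 1) → Fin 2) → R) :
    ∑ x, f x = ∑ b, ∑ x : Fin l → Fin 2, f (Fin.cons b x) := by
  rw [← Fintype.sum_prod_type', ← (Fin.consEquiv fun _ => Fin 2).sum_comp]
  rfl

/-- Operators on the last `l` factors, seen as operators on `l + 1` factors. -/
def onTail (l : ℕ) : Matrix (Fin l → Fin 2) (Fin l → Fin 2) R →*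
    Matrix (Fin (l + 1) → Fin 2) (Fin (l + 1) → Fin 2) R where
  toFun A := Matrix.of fun x y => if x 0 = y 0 then A (Fin.tail x) (Fin.tail y) else 0
  map_one' := by
    ext x y
    rw [← Fin.cons_self_tail x, ← Fin.cons_self_tail y]
    simp only [Matrix.one_apply, Fin.cons_inj]
    split_ifs <;> simp_all
  map_mul' A B := by
    ext x y
    simp [Matrix.mul_apply, sum_fin_succ_arrow, Fin.tail_cons]

theorem onTail_apply {l : ℕ} (A : Matrix (Fin l → Fin 2) (Fin l → Fin 2) R)
    (x y : Fin (l + 1) → Fin 2) :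
    onTail l A x y = if x 0 = y 0 then A (Fin.tail x) (Fin.tail y) else 0 :=
  rfl

theorem onFactor_succ {l : ℕ} (i : Fin l) (X : Matrix (Fin 2) (Fin 2) R) :
    onFactor (κ := fun _ : Fin (l + 1) => Fin 2) i.succ X =
      onTail l (onFactor (κ := fun _ : Fin l => Fin 2) i X) := by
  ext x y
  simp only [onFactor, onTail_apply, Fin.forall_fin_succ, ne_eq,
    Fin.succ_inj, Fin.tail]
  simp only [(Fin.succ_ne_zero i).symm, not_false_eq_true, forall_const, ite_and]
  congr

theorem prod_onFactor_apply {l : ℕ} (M : Fin l → Matrix (Fin 2) (Fin 2) R) (x y : Fin l → Fin 2) :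
    (List.ofFn fun i => onFactor (κ := fun _ : Fin l => Fin 2) i (M i)).prod x y =
      entryWord M x y := by
  induction l with
  | zero => simp [entryWord, Subsingleton.elim x y]
  | succ l ih =>
    have h : (List.ofFn fun i : Fin l =>
        onFactor (κ := fun _ : Fin (l + 1) => Fin 2) i.succ (M i.succ)) =
        (List.ofFn fun i : Fin l =>
          onFactor (κ := fun _ : Fin l => Fin 2) i (M i.succ)).map (onTail l) := by
      rw [List.map_ofFn]
      exact congrArg List.ofFn (funext fun i => onFactor_succ i _)
    -- The first operator changes only the first index and the rest leave it alone, so the only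
    -- intermediate sequence is `Fin.cons (y 0) (Fin.tail x)`.
    rw [List.ofFn_succ, List.prod_cons, h, ← map_list_prod, Matrix.mul_apply, sum_fin_succ_arrow,
      Finset.sum_eq_single (y 0), Finset.sum_eq_single (Fin.tail x)]
    · simp only [onTail_apply, Fin.cons_zero, Fin.tail_cons, if_true, ih,
        entryWord, List.ofFn_succ, List.prod_cons, onFactor]
      rw [if_pos]
      · rfl
      · intro j hj
        obtain ⟨j, rfl⟩ := Fin.exists_succ_eq.mpr hj
        rfl
    · intro w _ hw
      rw [onFactor, if_neg, zero_mul]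
      intro hj
      exact hw (funext fun j => (hj j.succ (Fin.succ_ne_zero j)).symm)
    · simp
    · intro b _ hb
      refine Finset.sum_eq_zero fun w _ => ?_
      simp [onTail_apply, hb]
    · simp

end Factors

/-! ### The fused transfer matrix as a symmetric trace. -/

section Fused

variable {N : ℕ} (twoS : Fin N → ℕ)

theorem permOperator_mul_apply {l : ℕ} (π : Equiv.Perm (Fin l))
    (A : Matrix (Fin l → Fin 2) (Fin l → Fin 2) (QOp twoS)) (x y : Fin l → Fin 2) :
    (permOperator twoS π * A) x y = ∑ z, if x = z ∘ π then A z y else 0 := by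
  simp [Matrix.mul_apply, permOperator]

theorem sum_permOperator_mul_apply {l : ℕ}
    (A : Matrix (Fin l → Fin 2) (Fin l → Fin 2) (QOp twoS)) (x y : Fin l → Fin 2) :
    ((∑ π : Equiv.Perm (Fin l), permOperator twoS π) * A) x y =
      ∑ z, permCount x z • A z y := by
  rw [Finset.sum_mul, Matrix.sum_apply]
  simp only [permOperator_mul_apply]
  rw [Finset.sum_comm]
  refine Finset.sum_congr rfl fun z _ => ?_
  rw [permCount, ← Finset.sum_filter, Finset.sum_const]

theorem permOperator_mul {l : ℕ} (π σ : Equiv.Perm (Fin l)) :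
    permOperator twoS π * permOperator twoS σ = permOperator twoS (σ * π) := by
  ext1 x y
  rw [permOperator_mul_apply, Finset.sum_eq_single (y ∘ σ)]
  · simp only [permOperator, Matrix.of_apply, if_true, Equiv.Perm.coe_mul, Function.comp_assoc]
    congr
  · intro z _ hz
    simp [permOperator, hz]
  · simp

theorem symmetrizer_mul_self (l : ℕ) :
    symmetrizer twoS l * symmetrizer twoS l = symmetrizer twoS l := by
  have h : (∑ π : Equiv.Perm (Fin l), permOperator twoS π) *
      ∑ π : Equiv.Perm (Fin l), permOperator twoS π =
        (l.factorial : ℂ) • ∑ π : Equiv.Perm (Fin l), permOperator twoS π := by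
    rw [Finset.sum_mul_sum]
    simp only [permOperator_mul]
    have : ∀ π : Equiv.Perm (Fin l), ∑ σ : Equiv.Perm (Fin l), permOperator twoS (σ * π) =
        ∑ σ : Equiv.Perm (Fin l), permOperator twoS σ := fun π =>
      Equiv.sum_comp (Equiv.mulRight π) fun σ => permOperator twoS σ
    simp only [this]
    rw [Finset.sum_const, Finset.card_univ, Fintype.card_perm, Fintype.card_fin]
    exact (Nat.cast_smul_eq_nsmul ℂ _ _).symm
  have hl : (l.factorial : ℂ) ≠ 0 := by exact_mod_cast l.factorial_ne_zero
  rw [symmetrizer, smul_mul_smul_comm, h, smul_smul, mul_assoc, inv_mul_cancel₀ hl, mul_one]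

theorem symmetrizer_apply_commute (l : ℕ) (x y : Fin l → Fin 2) (a : QOp twoS) :
    Commute (symmetrizer twoS l x y) a := by
  rw [symmetrizer, Matrix.smul_apply, Matrix.sum_apply]
  refine (Commute.sum_left _ _ _ fun π _ => ?_).smul_left _
  simp only [permOperator, Matrix.of_apply]
  split_ifs
  · exact Commute.one_left a
  · exact Commute.zero_left a

/-- The trace of matrices with operator entries is not cyclic in general; here it is because the
entries of the symmetrizer are scalar. -/
theorem trace_mul_symmetrizer (l : ℕ)
    (A : Matrix (Fin l → Fin 2) (Fin l → Fin 2) (QOp twoS)) :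
    (A * symmetrizer twoS l).trace = (symmetrizer twoS l * A).trace := by
  simp only [Matrix.trace, Matrix.diag, Matrix.mul_apply]
  rw [Finset.sum_comm]
  simp only [(symmetrizer_apply_commute twoS l _ _ _).eq]

variable (η : ℂ) (ξ : Fin N → ℂ) (K : Matrix (Fin 2) (Fin 2) ℂ)

/-- The monodromy matrices whose product is fused in `fusedMonodromy`. -/
noncomputable def monodromyChain (l : ℕ) (u : ℂ) : Fin l → Matrix (Fin 2) (Fin 2) (QOp twoS) :=
  fun i => monodromy twoS η ξ K (u + ((l : ℂ) - 1 - (i : ℕ)) * η)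

theorem fusedTransfer_eq_symTrace {l : ℕ} {u : ℂ}
    (h : FusibleChain (monodromyChain twoS η ξ K l u)) :
    fusedTransfer twoS η ξ K l u = symTrace (monodromyChain twoS η ξ K l u) := by
  rw [fusedTransfer, fusedMonodromy, trace_mul_symmetrizer, ← mul_assoc, symmetrizer_mul_self,
    symmetrizer, smul_mul_assoc, Matrix.trace_smul, Matrix.trace]
  simp only [Matrix.diag, sum_permOperator_mul_apply, prod_onFactor_apply]
  change (l.factorial : ℂ)⁻¹ •
    ∑ x, ∑ z, permCount x z • entryWord (monodromyChain twoS η ξ K l u) z x = _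
  rw [h.sum_permCount_nsmul, ← Nat.cast_smul_eq_nsmul ℂ, smul_smul, inv_mul_cancel₀, one_smul]
  exact_mod_cast l.factorial_ne_zero

end Fused

/-! ### Two-boson (Schwinger) realization of the spin operators. -/

section Oscillators

/-- The annihilation operator of the boson `b` from `d` particles to `d - 1` particles; the state
number `j` of `d` particles has `d - j` bosons `0` and `j` bosons `1`. -/
noncomputable def annih (d : ℕ) (b : Fin 2) : Matrix (Fin d) (Fin (d + 1)) ℂ :=
  if b = 0 then fun i j => if j = i.castSucc then ((Real.sqrt ((d : ℝ) - (i : ℕ)) : ℝ) : ℂ) else 0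
  else fun i j => if j = i.succ then ((Real.sqrt ((i : ℕ) + 1) : ℝ) : ℂ) else 0

/-- The creation operator of the boson `b` from `d - 1` particles to `d` particles. -/
noncomputable def creat (d : ℕ) (b : Fin 2) : Matrix (Fin (d + 1)) (Fin d) ℂ :=
  (annih d b).transpose

/-- The operator that replaces a boson `b` by a boson `c`. -/
noncomputable def glOp (d : ℕ) (c b : Fin 2) : Matrix (Fin (d + 1)) (Fin (d + 1)) ℂ :=
  creat d c * annih d b

theorem annih_zero_apply {d : ℕ} (i : Fin d) (j : Fin (d + 1)) :
    annih d 0 i j = if j = i.castSucc then ((Real.sqrt ((d : ℝ) - (i : ℕ)) : ℝ) : ℂ) else 0 := rfl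

theorem annih_one_apply {d : ℕ} (i : Fin d) (j : Fin (d + 1)) :
    annih d 1 i j = if j = i.succ then ((Real.sqrt ((i : ℕ) + 1) : ℝ) : ℂ) else 0 := rfl

theorem creat_apply {d : ℕ} (b : Fin 2) (i : Fin (d + 1)) (j : Fin d) :
    creat d b i j = annih d b j i := rfl

theorem ofReal_sqrt_mul_self {x : ℝ} (hx : 0 ≤ x) :
    ((Real.sqrt x : ℝ) : ℂ) * ((Real.sqrt x : ℝ) : ℂ) = (x : ℂ) := by
  rw [← Complex.ofReal_mul, Real.mul_self_sqrt hx]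

theorem glOp_zero_zero (d : ℕ) :
    glOp d 0 0 = Matrix.diagonal fun j : Fin (d + 1) => (d : ℂ) - (j : ℕ) := by
  ext i j
  rw [glOp, Matrix.mul_apply]
  simp only [creat_apply, annih_zero_apply]
  induction i using Fin.lastCases with
  | last =>
    rw [Finset.sum_eq_zero fun k _ => by rw [if_neg (Fin.castSucc_lt_last k).ne', zero_mul]]
    simp [Matrix.diagonal_apply]
  | cast i =>
    have hi : (0 : ℝ) ≤ (d : ℝ) - (i : ℕ) := sub_nonneg.mpr (by exact_mod_cast i.2.le)
    simp only [Fin.castSucc_inj, ite_mul, zero_mul, Finset.sum_ite_eq, Finset.mem_univ, if_true]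
    simp only [mul_ite, mul_zero, Matrix.diagonal_apply, ofReal_sqrt_mul_self hi, eq_comm (a := j)]
    simp

theorem glOp_one_one (d : ℕ) :
    glOp d 1 1 = Matrix.diagonal fun j : Fin (d + 1) => ((j : ℕ) : ℂ) := by
  ext i j
  rw [glOp, Matrix.mul_apply]
  simp only [creat_apply, annih_one_apply]
  induction i using Fin.cases with
  | zero =>
    rw [Finset.sum_eq_zero fun k _ => by rw [if_neg (Fin.succ_ne_zero k).symm, zero_mul]]
    simp [Matrix.diagonal_apply]
  | succ i =>
    have hi : (0 : ℝ) ≤ (i : ℕ) + 1 := by positivity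
    simp only [Fin.succ_inj, ite_mul, zero_mul, Finset.sum_ite_eq, Finset.mem_univ, if_true]
    simp only [mul_ite, mul_zero, Matrix.diagonal_apply, ofReal_sqrt_mul_self hi, eq_comm (a := j)]
    simp

theorem glOp_zero_one (d : ℕ) : glOp d 0 1 = spinPlus d := by
  ext i j
  rw [glOp, Matrix.mul_apply, spinPlus]
  simp only [creat_apply, annih_one_apply, annih_zero_apply]
  induction i using Fin.lastCases with
  | last =>
    rw [Finset.sum_eq_zero fun k _ => by rw [if_neg (Fin.castSucc_lt_last k).ne', zero_mul]]
    rw [if_neg]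
    simp only [Fin.val_last]; omega
  | cast i =>
    simp only [Fin.castSucc_inj, ite_mul, zero_mul, Finset.sum_ite_eq, Finset.mem_univ, if_true]
    simp only [mul_ite, mul_zero, Fin.ext_iff, Fin.val_succ, Fin.val_castSucc,
      eq_comm (a := (j : ℕ))]
    split_ifs with h
    · rw [← h, ← Complex.ofReal_mul, mul_comm, ← Real.sqrt_mul (by positivity)]
      push_cast
      ring_nf
    · rfl

theorem glOp_transpose (d : ℕ) (c b : Fin 2) : (glOp d c b).transpose = glOp d b c := by
  simp [glOp, creat, Matrix.transpose_mul]

theorem glOp_one_zero (d : ℕ) : glOp d 1 0 = spinMinus d := by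
  rw [spinMinus, ← glOp_zero_one, glOp_transpose]

theorem annih_mul_comm (d : ℕ) (b c : Fin 2) :
    annih d b * annih (d + 1) c = annih d c * annih (d + 1) b := by
  have h : annih d 0 * annih (d + 1) 1 = annih d 1 * annih (d + 1) 0 := by
    ext k m
    simp only [Matrix.mul_apply, annih_zero_apply, annih_one_apply, ite_mul, zero_mul,
      Finset.sum_ite_eq', Finset.mem_univ, if_true]
    simp only [mul_ite, mul_zero, Fin.succ_castSucc]
    split_ifs
    · rw [mul_comm]
      push_cast
      simp
    · rfl
  have hb : b = 0 ∨ b = 1 := by omega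
  have hc : c = 0 ∨ c = 1 := by omega
  rcases hb with rfl | rfl <;> rcases hc with rfl | rfl
  · rfl
  · exact h
  · exact h.symm
  · rfl

theorem creat_mul_comm (d : ℕ) (b c : Fin 2) :
    creat (d + 1) b * creat d c = creat (d + 1) c * creat d b := by
  simp only [creat, ← Matrix.transpose_mul]
  rw [annih_mul_comm]

/-- The canonical commutation relations on the states of `d` bosons; the left side passes through `d
+ 1` bosons. -/
theorem annih_mul_creat (d : ℕ) (b c : Fin 2) :
    annih (d + 1) b * creat (d + 1) c = glOp d c b + if b = c then 1 else 0 := by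
  have h01 : annih (d + 1) 0 * creat (d + 1) 1 = glOp d 1 0 := by
    rw [glOp_one_zero]
    ext k m
    simp only [Matrix.mul_apply, creat_apply, annih_zero_apply, annih_one_apply, ite_mul, zero_mul,
      Finset.sum_ite_eq', Finset.mem_univ, if_true]
    simp only [mul_ite, mul_zero, spinMinus, Matrix.transpose_apply, spinPlus, Fin.ext_iff,
      Fin.val_succ, Fin.val_castSucc, eq_comm (a := (k : ℕ))]
    split_ifs with h
    · rw [← h, ← Complex.ofReal_mul, mul_comm, ← Real.sqrt_mul (by positivity)]
      push_cast
      ring_nf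
    · rfl
  have h00 : annih (d + 1) 0 * creat (d + 1) 0 = glOp d 0 0 + 1 := by
    rw [glOp_zero_zero]
    ext k m
    have hk : (0 : ℝ) ≤ ((d + 1 : ℕ) : ℝ) - (k : ℕ) := sub_nonneg.mpr (by exact_mod_cast k.2.le)
    simp only [Matrix.mul_apply, creat_apply, annih_zero_apply, ite_mul, zero_mul,
      Finset.sum_ite_eq', Finset.mem_univ, if_true, mul_ite, mul_zero, Fin.castSucc_inj,
      Matrix.add_apply, Matrix.diagonal_apply, Matrix.one_apply, eq_comm (a := m)]
    split_ifs with h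
    · rw [h] at hk ⊢
      rw [ofReal_sqrt_mul_self hk]
      push_cast
      ring
    · simp
  have h11 : annih (d + 1) 1 * creat (d + 1) 1 = glOp d 1 1 + 1 := by
    rw [glOp_one_one]
    ext k m
    have hk : (0 : ℝ) ≤ (k : ℕ) + 1 := by positivity
    simp only [Matrix.mul_apply, creat_apply, annih_one_apply, ite_mul, zero_mul,
      Finset.sum_ite_eq', Finset.mem_univ, if_true, mul_ite, mul_zero, Fin.succ_inj,
      Matrix.add_apply, Matrix.diagonal_apply, Matrix.one_apply, eq_comm (a := m)]
    split_ifs with h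
    · rw [h] at hk ⊢
      rw [ofReal_sqrt_mul_self hk]
      push_cast
      ring
    · simp
  have hb : b = 0 ∨ b = 1 := by omega
  have hc : c = 0 ∨ c = 1 := by omega
  rcases hb with rfl | rfl <;> rcases hc with rfl | rfl
  · simpa using h00
  · simpa using h01
  · have := congrArg Matrix.transpose h01
    rw [Matrix.transpose_mul, glOp_transpose] at this
    simpa [creat] using this
  · simpa using h11

/-- Products of the operators `glOp` in terms of the normally ordered products
`W c f b e = creat c * creat f * annih b * annih e`. -/
theorem exists_glOp_mul (d : ℕ) :
    ∃ W : Fin 2 → Fin 2 → Fin 2 → Fin 2 → Matrix (Fin (d + 1)) (Fin (d + 1)) ℂ,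
      (∀ c f b e, W c f b e = W f c b e) ∧ (∀ c f b e, W c f b e = W c f e b) ∧
      ∀ c b f e, glOp d c b * glOp d f e = W c f b e + if b = f then glOp d c e else 0 := by
  cases d with
  -- Without bosons the normally ordered products would pass through a negative particle number; all
  -- `glOp 0 c b` vanish.
  | zero =>
    have h : ∀ c b, glOp 0 c b = 0 := fun c b => by
      ext i j; simp [glOp, Matrix.mul_apply]
    exact ⟨fun _ _ _ _ => 0, fun _ _ _ _ => rfl, fun _ _ _ _ => rfl, by simp [h]⟩
  | succ d =>
    refine ⟨fun c f b e => creat (d + 1) c * creat d f * (annih d b * annih (d + 1) e),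
      fun c f b e => ?_, fun c f b e => ?_, fun c b f e => ?_⟩
    · simp only [creat_mul_comm d c f]
    · simp only [annih_mul_comm d b e]
    · rw [glOp, glOp, Matrix.mul_assoc, ← Matrix.mul_assoc (annih _ _), annih_mul_creat,
        Matrix.add_mul, Matrix.mul_add, glOp]
      congr 1
      · simp only [Matrix.mul_assoc]
      · split_ifs <;> simp [glOp]

theorem glOp_trace (d : ℕ) : glOp d 0 0 + glOp d 1 1 = (d : ℂ) • 1 := by
  rw [glOp_zero_zero, glOp_one_one, Matrix.diagonal_add, Matrix.smul_one_eq_diagonal]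
  simp

end Oscillators

/-! ### The exchange (RTT) relation and commuting traces. -/

section Exchange

variable {R : Type*} [Ring R] [Algebra ℂ R]

/-- The exchange relation `(c + η P) A₁ B₂ = B₂ A₁ (c + η P)` of a pair of matrices. -/
def Exchange (c η : ℂ) (A B : Matrix (Fin 2) (Fin 2) R) : Prop :=
  ∀ i j k l, c • (A i j * B k l) + η • (A k j * B i l) = c • (B k l * A i j) + η • (B k j * A i l)

/-- After the mutually commuting entries are sorted, `c + η P` is moved through `A`, `B` first and
through `A'`, `B'` next. -/
theorem Exchange.mul {c η : ℂ} {A A' B B' : Matrix (Fin 2) (Fin 2) R} (h : Exchange c η A B)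
    (h' : Exchange c η A' B') (hA : ∀ i j k l, Commute (A' i j) (B k l))
    (hB : ∀ i j k l, Commute (B' i j) (A k l)) : Exchange c η (A * A') (B * B') := by
  have hs : ∀ (i j k l m n : Fin 2), A i m * A' m j * (B k n * B' n l) =
      A i m * B k n * (A' m j * B' n l) := fun i j k l m n => by
    rw [mul_assoc, ← mul_assoc (A' m j), (hA m j k n).eq]; simp only [mul_assoc]
  have hs' : ∀ (i j k l m n : Fin 2), B k n * B' n l * (A i m * A' m j) =
      B k n * A i m * (B' n l * A' m j) := fun i j k l m n => by
    rw [mul_assoc, ← mul_assoc (B' n l), (hB n l i m).eq]; simp only [mul_assoc]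
  have h1 : ∀ i j k l m n, c • (A i m * B k n * (A' m j * B' n l)) +
      η • (A k m * B i n * (A' m j * B' n l)) = c • (B k n * A i m * (A' m j * B' n l)) +
        η • (B k m * A i n * (A' m j * B' n l)) := fun i j k l m n => by
    have := congrArg (· * (A' m j * B' n l)) (h i m k n)
    simpa only [add_mul, smul_mul_assoc] using this
  have h2 : ∀ i j k l m n, c • (B k n * A i m * (A' m j * B' n l)) +
      η • (B k n * A i m * (A' n j * B' m l)) = c • (B k n * A i m * (B' n l * A' m j)) +
        η • (B k n * A i m * (B' n j * A' m l)) := fun i j k l m n => by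
    have := congrArg (B k n * A i m * ·) (h' m j n l)
    simpa only [mul_add, mul_smul_comm] using this
  intro i j k l
  simp only [Matrix.mul_apply, Finset.sum_mul_sum, Finset.smul_sum, hs, hs']
  calc _ = (∑ m, ∑ n, c • (B k n * A i m * (A' m j * B' n l))) +
        ∑ m, ∑ n, η • (B k m * A i n * (A' m j * B' n l)) := by
        simp only [← Finset.sum_add_distrib, h1]
    -- Renaming `m ↔ n` in the permuted term brings it to the form to which the relation of `A'`,
    -- `B'` applies.
    _ = (∑ m, ∑ n, c • (B k n * A i m * (A' m j * B' n l))) +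
        ∑ m, ∑ n, η • (B k n * A i m * (A' n j * B' m l)) := congrArg _ Finset.sum_comm
    _ = (∑ m, ∑ n, c • (B k n * A i m * (B' n l * A' m j))) +
        ∑ m, ∑ n, η • (B k n * A i m * (B' n j * A' m l)) := by
        simp only [← Finset.sum_add_distrib, h2]
    _ = _ := congrArg₂ _ Finset.sum_comm Finset.sum_comm

theorem Exchange.map {S : Type*} [Ring S] [Algebra ℂ S] (f : R →ₐ[ℂ] S) {c η : ℂ}
    {A B : Matrix (Fin 2) (Fin 2) R} (h : Exchange c η A B) :
    Exchange c η (A.map f) (B.map f) := fun i j k l => by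
  have := congrArg f (h i j k l)
  simpa only [map_add, map_smul, map_mul, Matrix.map_apply] using this

theorem exchange_algebraMap (c η : ℂ) (K : Matrix (Fin 2) (Fin 2) ℂ) :
    Exchange c η (K.map (algebraMap ℂ R)) (K.map (algebraMap ℂ R)) := fun i j k l => by
  simp only [Matrix.map_apply, ← map_mul]
  rw [mul_comm (K i j), mul_comm (K k j)]

/-- In the sum of the diagonal components of both relations the terms with `η` cancel, leaving `2c`
times the commutator. No inverse of `c + η P` is needed, so the points `c = ±η` are no exception. -/
theorem Exchange.commute_trace {c η : ℂ} {A B : Matrix (Fin 2) (Fin 2) R}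
    (h : Exchange c η A B) (h' : Exchange (-c) η B A) (hc : c ≠ 0) :
    Commute A.trace B.trace := by
  have e : (2 * c) • (A.trace * B.trace - B.trace * A.trace) = 0 := by
    simp only [Matrix.trace, Matrix.diag, Fin.sum_univ_two, mul_add, add_mul]
    linear_combination (norm := module) h 0 0 0 0 + h 0 0 1 1 + h 1 1 0 0 + h 1 1 1 1 +
      h' 0 0 0 0 + h' 0 0 1 1 + h' 1 1 0 0 + h' 1 1 1 1
  rw [smul_eq_zero, or_iff_right (mul_ne_zero two_ne_zero hc)] at e
  exact sub_eq_zero.mp e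

end Exchange

/-! ### Transport of fusibility along ring homomorphisms. -/

section FusibleMaps

variable {R S : Type*} [Ring R] [Ring S]

theorem qMinor_map (f : R →+* S) (A B : Matrix (Fin 2) (Fin 2) R) (i k : Fin 2) :
    qMinor (A.map f) (B.map f) i k = f (qMinor A B i k) := by
  simp [qMinor]

theorem Fusible.map (f : R →+* S) {A B : Matrix (Fin 2) (Fin 2) R} (h : Fusible A B) :
    Fusible (A.map f) (B.map f) where
  zero_zero := by rw [qMinor_map, h.zero_zero, map_zero]
  one_one := by rw [qMinor_map, h.one_one, map_zero]
  one_zero := by rw [qMinor_map, qMinor_map, h.one_zero, map_neg]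

theorem fusible_of_comm {R : Type*} [CommRing R] (K : Matrix (Fin 2) (Fin 2) R) :
    Fusible K K := by
  constructor <;> simp only [qMinor] <;> ring

theorem colWord_map (f : R →+* S) {l : ℕ} (M : Fin l → Matrix (Fin 2) (Fin 2) R)
    (y : Fin l → Fin 2) :
    colWord (fun i => (M i).map f) y = (colWord M y).map f := by
  rw [colWord, colWord, Polynomial.map_list_prod, List.map_ofFn]
  congr 2
  funext i
  simp [colPoly]

end FusibleMaps

/-! ### One site: Lax matrix, quantum determinant and degeneration. -/

section Site

/-- The Lax matrix of one site, with entries in the operators of this site. -/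
noncomputable def siteLax (d : ℕ) (η u : ℂ) :
    Matrix (Fin 2) (Fin 2) (Matrix (Fin (d + 1)) (Fin (d + 1)) ℂ) :=
  Matrix.of fun x y => (if x = y then (u + η / 2 - (d : ℂ) / 2 * η) else 0) • 1 + η • glOp d y x

/-- After normal ordering the quartic terms match by the symmetries of `W`; what remains is linear
in the `glOp`. -/
theorem siteLax_exchange (d : ℕ) (η u v : ℂ) :
    Exchange (u - v) η (siteLax d η u) (siteLax d η v) := by
  intro i j k l
  obtain ⟨W, h1, h2, h⟩ := exists_glOp_mul d
  have e1 : u - v = u + η / 2 - (d : ℂ) / 2 * η - (v + η / 2 - (d : ℂ) / 2 * η) := by ring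
  -- The Kronecker deltas are made scalar factors, which `module` treats as atoms; this avoids a
  -- case split over the indices.
  have hδ : ∀ (p : Prop) [Decidable p] (a : ℂ), (if p then a else 0) = a * if p then 1 else 0 :=
    fun p _ a => by simp
  have hE : ∀ (p : Prop) [Decidable p] (a : Matrix (Fin (d + 1)) (Fin (d + 1)) ℂ),
    (if p then a else 0) = (if p then (1 : ℂ) else 0) • a := fun p _ a => by simp
  simp only [siteLax, Matrix.of_apply]
  rw [e1]
  generalize u + η / 2 - (d : ℂ) / 2 * η = a
  generalize v + η / 2 - (d : ℂ) / 2 * η = b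
  simp only [mul_add, add_mul, smul_mul_smul_comm, one_mul, mul_one, h, h1 l j, h2 j l k i]
  rw [hδ (i = j) a, hδ (k = l) b, hδ (k = j) a, hδ (k = j) b,
    hδ (i = l) a, hδ (i = l) b, hE (i = l), hE (k = j), hE (k = l)]
  module

/-- At `u - v = η` the matrix `c + η P` is `2η` times the symmetrizer, which explains the shift. The
exchange relation says nothing when `η = 0`, so the minors are computed directly. -/
theorem siteLax_fusible (d : ℕ) (η u v : ℂ) (huv : v = u - η) :
    Fusible (siteLax d η u) (siteLax d η v) := by
  obtain ⟨W, h1, h2, h⟩ := exists_glOp_mul d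
  have e1 : v + η / 2 - (d : ℂ) / 2 * η = u + η / 2 - (d : ℂ) / 2 * η - η := by rw [huv]; ring
  constructor <;> simp only [qMinor, siteLax, Matrix.of_apply, e1] <;>
    generalize u + η / 2 - (d : ℂ) / 2 * η = a <;>
    simp only [mul_add, add_mul, smul_mul_smul_comm, one_mul, mul_one, h, h1 1 0, h2 _ _ 1 0,
      Fin.isValue, zero_ne_one, one_ne_zero, if_true, if_false] <;>
    module

/-- Normal ordering leaves only the total boson number, which is the scalar `d`. -/
theorem qMinor_siteLax (d : ℕ) (η u v : ℂ) (huv : v = u - η) :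
    qMinor (siteLax d η u) (siteLax d η v) 0 1 =
      ((u + η / 2 + (d : ℂ) / 2 * η) * (v + η / 2 - (d : ℂ) / 2 * η)) • 1 := by
  obtain ⟨W, h1, h2, h⟩ := exists_glOp_mul d
  have e1 : v + η / 2 - (d : ℂ) / 2 * η = u + η / 2 - (d : ℂ) / 2 * η - η := by rw [huv]; ring
  have e2 : u + η / 2 + (d : ℂ) / 2 * η = u + η / 2 - (d : ℂ) / 2 * η + d * η := by ring
  have ht : glOp d 0 0 = (d : ℂ) • 1 - glOp d 1 1 := eq_sub_of_add_eq (glOp_trace d)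
  simp only [qMinor, siteLax, Matrix.of_apply, e1, e2]
  generalize u + η / 2 - (d : ℂ) / 2 * η = a
  simp only [mul_add, add_mul, smul_mul_smul_comm, one_mul, mul_one, h, h1 1 0, Fin.isValue,
    zero_ne_one, one_ne_zero, if_true, if_false]
  rw [ht]
  module

/-- The annihilation operator of the boson `0 + X 1`. -/
noncomputable def annihX (d : ℕ) : Matrix (Fin d) (Fin (d + 1)) ℂ[X] :=
  (annih d 0).map C + (X : ℂ[X]) • (annih d 1).map C

/-- The column generating polynomials of the Lax matrix at the points where it degenerates. -/
noncomputable def degenerateLax (d : ℕ) (i : ℕ) (b : Fin 2) :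
    Matrix (Fin (d + 1)) (Fin (d + 1)) ℂ[X] :=
  (creat d b).map C * annihX d - ((i : ℂ[X]) * X ^ (b : ℕ)) • 1

theorem annihX_mul_creat (d : ℕ) (b : Fin 2) :
    annihX (d + 1) * (creat (d + 1) b).map C =
      (creat d b).map C * annihX d + (X ^ (b : ℕ) : ℂ[X]) • 1 := by
  simp only [annihX, Matrix.add_mul, Matrix.mul_add, Matrix.smul_mul, Matrix.mul_smul]
  rw [← Matrix.map_mul, ← Matrix.map_mul, ← Matrix.map_mul, ← Matrix.map_mul, annih_mul_creat,
    annih_mul_creat]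
  have hb : b = 0 ∨ b = 1 := by omega
  rcases hb with rfl | rfl <;>
  simp [glOp, Matrix.map_add, Matrix.map_one, smul_add] <;> abel

/-- Moving `a₀ + X a₁` past `a_b†` produces `X ^ b`, which lowers the subtracted multiple by one. -/
theorem annihX_mul_degenerateLax (d i : ℕ) (b : Fin 2) :
    annihX (d + 1) * degenerateLax (d + 1) (i + 1) b = degenerateLax d i b * annihX (d + 1) := by
  rw [degenerateLax, degenerateLax, Matrix.mul_sub, ← Matrix.mul_assoc, annihX_mul_creat,
    Matrix.sub_mul, Matrix.add_mul, Matrix.mul_smul, Matrix.mul_one, Matrix.smul_mul,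
    Matrix.smul_mul, Matrix.one_mul]
  push_cast
  rw [add_mul, add_smul, one_mul]
  abel

theorem annihX_mul_prod_degenerateLax (d : ℕ) {m : ℕ} (k : ℕ) (y : Fin m → Fin 2) :
    annihX (d + 1) * (List.ofFn fun i : Fin m => degenerateLax (d + 1) (i + k + 1) (y i)).prod =
      (List.ofFn fun i : Fin m => degenerateLax d (i + k) (y i)).prod * annihX (d + 1) := by
  induction m generalizing k with
  | zero => simp
  | succ m ih =>
    have := ih (k + 1) fun i => y i.succ
    simp only [List.ofFn_succ, List.prod_cons, Fin.val_zero, Fin.val_succ, zero_add]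
    rw [← Matrix.mul_assoc, annihX_mul_degenerateLax, Matrix.mul_assoc, Matrix.mul_assoc]
    simp only [add_right_comm _ 1 k]
    exact congrArg _ this

/-- The subtractions `0, 1, …, d` are those that normal ordering removes: the product is a product
of creation operators times `(a₀ + X a₁)^(d+1)`, which is zero on `d` bosons. -/
theorem prod_degenerateLax (d : ℕ) (y : Fin (d + 1) → Fin 2) :
    (List.ofFn fun i : Fin (d + 1) => degenerateLax d i (y i)).prod = 0 := by
  induction d with
  | zero =>
    ext i j
    simp [degenerateLax, Matrix.mul_apply]
  | succ d ih =>
    have h := annihX_mul_prod_degenerateLax d 0 fun i : Fin (d + 1) => y i.succ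
    simp only [add_zero] at h
    rw [ih] at h
    rw [List.ofFn_succ, List.prod_cons]
    simp only [Fin.val_zero, Fin.val_succ]
    -- The first factor has no subtraction, so its annihilation operator can be pushed through the
    -- others, turning them into the product for one boson less.
    have h0 : degenerateLax (d + 1) 0 (y 0) = (creat (d + 1) (y 0)).map C * annihX (d + 1) := by
      simp [degenerateLax]
    rw [h0, Matrix.mul_assoc, h, Matrix.zero_mul, Matrix.mul_zero]

/-- Summing `X ^ x · a_b† a_x` over the rows `x` gives `a_b† (a₀ + X a₁)`. Via `matPolyEquiv` the
polynomials with matrix coefficients become matrices of polynomials, so that operators between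
different boson numbers can be used. -/
theorem colPoly_siteLax (d : ℕ) (η u : ℂ) (i : ℕ) (b : Fin 2)
    (hu : u + η / 2 - (d : ℂ) / 2 * η = -(i * η)) :
    matPolyEquiv.symm (colPoly (siteLax d η u) b) = C η • degenerateLax d i b := by
  have h1 : ∀ a : ℂ, (a • (1 : Matrix (Fin (d + 1)) (Fin (d + 1)) ℂ)).map C =
      C a • (1 : Matrix (Fin (d + 1)) (Fin (d + 1)) ℂ[X]) := fun a => by
    ext x y : 1
    simp only [Matrix.map_apply, Matrix.smul_apply, Matrix.one_apply, smul_eq_mul]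
    split_ifs <;> simp
  have h2 : ∀ a : Matrix (Fin (d + 1)) (Fin (d + 1)) ℂ, (η • a).map C = C η • a.map C :=
    fun a => by ext x y : 1; simp
  have h3 : ∀ a : Matrix (Fin (d + 1)) (Fin (d + 1)) ℂ[X],
      a * Matrix.diagonal (fun _ => X) = (X : ℂ[X]) • a := fun a => by
    ext x y : 1
    simp [Matrix.mul_diagonal, mul_comm]
  have hb : b = 0 ∨ b = 1 := by omega
  simp only [colPoly, siteLax, Matrix.of_apply, hu, map_add, map_mul, matPolyEquiv_symm_C,
    matPolyEquiv_symm_X, degenerateLax, annihX, Matrix.mul_add, Matrix.mul_smul, h3]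
  rcases hb with rfl | rfl <;>
    simp only [h1, h2, glOp, Matrix.map_mul, Fin.isValue, zero_ne_one, one_ne_zero, if_true,
      if_false, map_neg, map_mul, map_natCast, map_zero, Fin.val_zero, Fin.val_one] <;>
    module

theorem colWord_siteLax (d : ℕ) (η : ℂ) (u : Fin (d + 1) → ℂ)
    (hu : ∀ i, u i + η / 2 - (d : ℂ) / 2 * η = -((i : ℕ) * η)) (y : Fin (d + 1) → Fin 2) :
    colWord (fun i => siteLax d η (u i)) y = 0 := by
  refine matPolyEquiv.symm.injective ?_
  rw [map_zero, colWord, map_list_prod, List.map_ofFn]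
  have h : (matPolyEquiv.symm ∘ fun i => colPoly (siteLax d η (u i)) (y i)) =
      fun i : Fin (d + 1) =>
        (C η • (1 : Matrix (Fin (d + 1)) (Fin (d + 1)) ℂ[X])) * degenerateLax d i (y i) :=
    funext fun i => by
      rw [Function.comp, colPoly_siteLax d η (u i) i (y i) (hu i), Matrix.smul_mul, Matrix.one_mul]
  rw [h, prod_ofFn_mul _ _ fun i j => (Commute.one_right _).smul_right _, prod_degenerateLax,
    mul_zero]

end Site

/-! ### Embedding of the one-site operators into the chain. -/

section OnFactor

variable {m : ℕ} {κ : Fin m → Type*} [∀ j, DecidableEq (κ j)]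

theorem onFactor_one (i : Fin m) :
    (onFactor i (1 : Matrix (κ i) (κ i) ℂ) : Matrix (∀ j, κ j) (∀ j, κ j) ℂ) = 1 := by
  ext x y
  simp only [onFactor, Matrix.one_apply]
  by_cases h : x = y
  · subst h; simp
  · rw [if_neg h]
    split_ifs with h1 h2
    · exact absurd (funext fun k => if hk : k = i then hk ▸ h2 else h1 k hk) h
    all_goals rfl

variable [∀ j, Fintype (κ j)]

theorem onFactor_mul_onFactor_of_ne {i j : Fin m} (hij : i ≠ j) (A : Matrix (κ i) (κ i) ℂ)
    (B : Matrix (κ j) (κ j) ℂ) (x y : ∀ j, κ j) :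
    (onFactor i A * onFactor j B) x y =
      if ∀ k, k ≠ i → k ≠ j → x k = y k then A (x i) (y i) * B (x j) (y j) else 0 := by
  rw [Matrix.mul_apply, Finset.sum_eq_single (Function.update x i (y i))]
  · have h1 : ∀ k, k ≠ i → x k = Function.update x i (y i) k := fun k hk => by simp [hk]
    have h2 : (∀ k, k ≠ j → Function.update x i (y i) k = y k) ↔
        ∀ k, k ≠ i → k ≠ j → x k = y k := by
      refine forall_congr' fun k => ?_
      by_cases hk : k = i
      · subst hk; simp
      · simp [hk]
    simp only [onFactor]
    rw [if_pos h1]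
    simp only [h2, Function.update_self, Function.update_of_ne hij.symm, mul_ite, mul_zero]
  · intro w _ hw
    simp only [onFactor]
    split_ifs with h1 h2
    · refine absurd (funext fun k => ?_) hw
      by_cases hk : k = i
      · subst hk; simp [h2 k hij]
      · simp [hk, h1 k hk]
    all_goals simp
  · simp

theorem onFactor_mul (i : Fin m) (A B : Matrix (κ i) (κ i) ℂ) :
    (onFactor i (A * B) : Matrix (∀ j, κ j) (∀ j, κ j) ℂ) = onFactor i A * onFactor i B := by
  ext x y
  have hin : Function.Injective fun b : κ i => Function.update x i b :=
    Function.update_injective x i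
  rw [Matrix.mul_apply, ← Fintype.sum_of_injective (fun b => Function.update x i b) hin
    (fun b => if ∀ j, j ≠ i → x j = y j then A (x i) b * B b (y i) else 0)]
  · simp only [onFactor, Matrix.mul_apply]
    split_ifs <;> simp
  · intro w hw
    simp only [onFactor]
    rw [if_neg, zero_mul]
    intro h
    refine hw ⟨w i, funext fun k => ?_⟩
    by_cases hk : k = i
    · subst hk; simp
    · simp [hk, h k hk]
  · intro b
    have h1 : ∀ k, k ≠ i → x k = Function.update x i b k := fun k hk => by simp [hk]
    have h2 : (∀ k, k ≠ i → Function.update x i b k = y k) ↔ ∀ k, k ≠ i → x k = y k :=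
      forall_congr' fun k => forall_congr' fun hk => by rw [Function.update_of_ne hk]
    simp only [onFactor, if_pos h1, h2, Function.update_self, mul_ite, mul_zero]

theorem onFactor_commute {i j : Fin m} (hij : i ≠ j) (A : Matrix (κ i) (κ i) ℂ)
    (B : Matrix (κ j) (κ j) ℂ) :
    Commute (onFactor i A : Matrix (∀ j, κ j) (∀ j, κ j) ℂ) (onFactor j B) := by
  ext x y
  rw [onFactor_mul_onFactor_of_ne hij, onFactor_mul_onFactor_of_ne hij.symm]
  simp only [mul_comm (A _ _), imp.swap (a := _ ≠ i)]

/-- The embedding of the operators of one factor, as a homomorphism of algebras. -/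
def onFactorHom (i : Fin m) :
    Matrix (κ i) (κ i) ℂ →ₐ[ℂ] Matrix (∀ j, κ j) (∀ j, κ j) ℂ :=
  AlgHom.ofLinearMap
    { toFun := onFactor i
      map_add' := fun A B => by
        ext x y; simp only [onFactor, Matrix.add_apply]; split_ifs <;> simp
      map_smul' := fun c A => by
        ext x y; simp only [onFactor, Matrix.smul_apply]; split_ifs <;> simp }
    (onFactor_one i) (onFactor_mul i)

end OnFactor

/-! ### Matrices with mutually commuting entries. -/

section Commutation

variable {R : Type*} [Ring R]

/-- All entries of `A` commute with all entries of `B`. -/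
def EntriesCommute (A B : Matrix (Fin 2) (Fin 2) R) : Prop :=
  ∀ i j k l, Commute (A i j) (B k l)

theorem EntriesCommute.symm {A B : Matrix (Fin 2) (Fin 2) R} (h : EntriesCommute A B) :
    EntriesCommute B A :=
  fun i j k l => (h k l i j).symm

theorem EntriesCommute.mul_right {A B B' : Matrix (Fin 2) (Fin 2) R} (h : EntriesCommute A B)
    (h' : EntriesCommute A B') : EntriesCommute A (B * B') := fun i j k l => by
  rw [Matrix.mul_apply]
  exact Commute.sum_right _ _ _ fun m _ => (h i j k m).mul_right (h' i j m l)

theorem EntriesCommute.mul_left {A A' B : Matrix (Fin 2) (Fin 2) R} (h : EntriesCommute A B)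
    (h' : EntriesCommute A' B) : EntriesCommute (A * A') B :=
  (h.symm.mul_right h'.symm).symm

theorem entriesCommute_one (A : Matrix (Fin 2) (Fin 2) R) : EntriesCommute A 1 :=
  fun i j k l => by
    rw [Matrix.one_apply]
    split_ifs
    · exact Commute.one_right _
    · exact Commute.zero_right _

theorem entriesCommute_algebraMap [Algebra ℂ R] (A : Matrix (Fin 2) (Fin 2) R)
    (K : Matrix (Fin 2) (Fin 2) ℂ) : EntriesCommute A (K.map (algebraMap ℂ R)) :=
  fun _ _ _ _ => Algebra.commute_algebraMap_right _ _

theorem EntriesCommute.list_prod {A : Matrix (Fin 2) (Fin 2) R}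
    {L : List (Matrix (Fin 2) (Fin 2) R)} (h : ∀ B ∈ L, EntriesCommute A B) :
    EntriesCommute A L.prod := by
  induction L with
  | nil => exact entriesCommute_one A
  | cons B L ih =>
    rw [List.prod_cons]
    exact (h B (by simp)).mul_right (ih fun B' hB' => h B' (by simp [hB']))

end Commutation

/-! ### Monodromy matrix, quantum determinant and fusion hierarchy. -/

section Monodromy

variable {N : ℕ} (twoS : Fin N → ℕ) (η : ℂ) (ξ : Fin N → ℂ) (K : Matrix (Fin 2) (Fin 2) ℂ)

/-- With `2s` bosons, `S^z` is `a₀† a₀ - s = s - a₁† a₁`, so both diagonal entries acquire the same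
scalar part. -/
theorem lax_eq_map (n : Fin N) (u : ℂ) :
    lax twoS η n u = (siteLax (twoS n) η u).map
      (onFactorHom (κ := fun m => Fin (twoS m + 1)) n) := by
  have h0 : (u • 1 + η • ((1 / 2 : ℂ) • 1 + spinZ (twoS n)) :
      Matrix (Fin (twoS n + 1)) (Fin (twoS n + 1)) ℂ) = siteLax (twoS n) η u 0 0 := by
    simp only [siteLax, Matrix.of_apply, glOp_zero_zero, spinZ, if_true,
      Matrix.smul_one_eq_diagonal, Matrix.diagonal_add, ← Matrix.diagonal_smul]
    congr 1; funext i; simp; ring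
  have h1 : (u • 1 + η • ((1 / 2 : ℂ) • 1 - spinZ (twoS n)) :
      Matrix (Fin (twoS n + 1)) (Fin (twoS n + 1)) ℂ) = siteLax (twoS n) η u 1 1 := by
    simp only [siteLax, Matrix.of_apply, glOp_one_one, spinZ, if_true,
      Matrix.smul_one_eq_diagonal, Matrix.diagonal_add, Matrix.diagonal_sub,
      ← Matrix.diagonal_smul]
    congr 1; funext i; simp; ring
  have h2 : η • spinMinus (twoS n) = siteLax (twoS n) η u 0 1 := by
    simp [siteLax, glOp_one_zero]
  have h3 : η • spinPlus (twoS n) = siteLax (twoS n) η u 1 0 := by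
    simp [siteLax, glOp_zero_one]
  rw [lax, h0, h1, h2, h3]
  ext i j : 1
  have hi : i = 0 ∨ i = 1 := by omega
  have hj : j = 0 ∨ j = 1 := by omega
  rcases hi with rfl | rfl <;> rcases hj with rfl | rfl <;> rfl

theorem lax_entriesCommute {n m : Fin N} (h : n ≠ m) (u v : ℂ) :
    EntriesCommute (lax twoS η n u) (lax twoS η m v) := fun i j k l => by
  rw [lax_eq_map, lax_eq_map]
  exact onFactor_commute h _ _

/-- The product of the Lax operators of a list of sites. -/
noncomputable def laxProd (L : List (Fin N)) (u : ℂ) : Matrix (Fin 2) (Fin 2) (QOp twoS) :=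
  (L.map fun n => lax twoS η n (u - ξ n)).prod

theorem laxProd_cons (n : Fin N) (L : List (Fin N)) (u : ℂ) :
    laxProd twoS η ξ (n :: L) u = lax twoS η n (u - ξ n) * laxProd twoS η ξ L u := by
  simp [laxProd]

theorem laxProd_append (L L' : List (Fin N)) (u : ℂ) :
    laxProd twoS η ξ (L ++ L') u = laxProd twoS η ξ L u * laxProd twoS η ξ L' u := by
  simp [laxProd]

theorem monodromy_eq (u : ℂ) :
    monodromy twoS η ξ K u =
      K.map (algebraMap ℂ (QOp twoS)) * laxProd twoS η ξ (List.finRange N).reverse u := by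
  rw [monodromy, laxProd, List.map_reverse, List.ofFn_eq_map]

theorem laxProd_entriesCommute_lax {n : Fin N} {L : List (Fin N)} (h : n ∉ L) (u v : ℂ) :
    EntriesCommute (lax twoS η n u) (laxProd twoS η ξ L v) := by
  refine EntriesCommute.list_prod fun B hB => ?_
  obtain ⟨m, hm, rfl⟩ := List.mem_map.mp hB
  exact lax_entriesCommute twoS η (ne_of_mem_of_not_mem hm h).symm _ _

theorem laxProd_entriesCommute {L L' : List (Fin N)} (h : L.Disjoint L') (u v : ℂ) :
    EntriesCommute (laxProd twoS η ξ L u) (laxProd twoS η ξ L' v) := by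
  refine (EntriesCommute.list_prod fun B hB => ?_).symm
  obtain ⟨m, hm, rfl⟩ := List.mem_map.mp hB
  exact (laxProd_entriesCommute_lax twoS η ξ (h hm) _ _).symm

theorem laxProd_exchange {L : List (Fin N)} (hL : L.Nodup) (u v : ℂ) :
    Exchange (u - v) η (laxProd twoS η ξ L u) (laxProd twoS η ξ L v) := by
  induction L with
  | nil =>
    have := exchange_algebraMap (R := QOp twoS) (u - v) η 1
    rwa [Matrix.map_one _ (map_zero _) (map_one _)] at this
  | cons n L ih =>
    rw [List.nodup_cons] at hL
    have h := (siteLax_exchange (twoS n) η (u - ξ n) (v - ξ n)).map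
      (onFactorHom (κ := fun m => Fin (twoS m + 1)) n)
    rw [← lax_eq_map, ← lax_eq_map, sub_sub_sub_cancel_right] at h
    rw [laxProd_cons, laxProd_cons]
    exact h.mul (ih hL.2) (laxProd_entriesCommute_lax twoS η ξ hL.1 _ _).symm
      (laxProd_entriesCommute_lax twoS η ξ hL.1 _ _).symm

theorem monodromy_exchange (u v : ℂ) :
    Exchange (u - v) η (monodromy twoS η ξ K u) (monodromy twoS η ξ K v) := by
  rw [monodromy_eq, monodromy_eq]
  exact (exchange_algebraMap _ _ K).mul
    (laxProd_exchange twoS η ξ (List.nodup_reverse.mpr (List.nodup_finRange N)) u v)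
    (entriesCommute_algebraMap _ K) (entriesCommute_algebraMap _ K)

theorem transfer_commute (u v : ℂ) :
    Commute (transfer twoS η ξ K u) (transfer twoS η ξ K v) := by
  by_cases h : u = v
  · rw [h]
  · refine (monodromy_exchange twoS η ξ K u v).commute_trace ?_ (sub_ne_zero.mpr h)
    rw [neg_sub]
    exact monodromy_exchange twoS η ξ K v u

theorem laxProd_fusible {L : List (Fin N)} (hL : L.Nodup) (u : ℂ) :
    Fusible (laxProd twoS η ξ L u) (laxProd twoS η ξ L (u - η)) := by
  induction L with
  | nil => exact fusible_one
  | cons n L ih =>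
    rw [List.nodup_cons] at hL
    have h := (siteLax_fusible (twoS n) η (u - ξ n) (u - η - ξ n) (by ring)).map
      (onFactorHom (κ := fun m => Fin (twoS m + 1)) n).toRingHom
    rw [laxProd_cons, laxProd_cons, lax_eq_map, lax_eq_map]
    refine h.mul (ih hL.2) ?_
    have := (laxProd_entriesCommute_lax twoS η ξ hL.1 (u - η - ξ n) u).symm
    rwa [lax_eq_map] at this

theorem qMinor_laxProd {L : List (Fin N)} (hL : L.Nodup) (u : ℂ) :
    qMinor (laxProd twoS η ξ L u) (laxProd twoS η ξ L (u - η)) 0 1 =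
      algebraMap ℂ (QOp twoS) (L.map fun n => (u - (ξ n - η / 2) + (twoS n : ℂ) / 2 * η) *
        (u - η - (ξ n - η / 2) - (twoS n : ℂ) / 2 * η)).prod := by
  induction L with
  | nil => simp [laxProd, qMinor]
  | cons n L ih =>
    rw [List.nodup_cons] at hL
    have h := qMinor_map (onFactorHom (κ := fun m => Fin (twoS m + 1)) n).toRingHom
      (siteLax (twoS n) η (u - ξ n)) (siteLax (twoS n) η (u - η - ξ n)) 0 1
    rw [qMinor_siteLax _ _ _ _ (by ring), ← Algebra.algebraMap_eq_smul_one] at h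
    rw [laxProd_cons, laxProd_cons,
      qMinor_mul (laxProd_fusible twoS η ξ hL.2 u)
        (laxProd_entriesCommute_lax twoS η ξ hL.1 _ _).symm, ih hL.2, lax_eq_map, lax_eq_map,
      List.map_cons, List.prod_cons, map_mul]
    congr 1
    refine h.trans (((onFactorHom (κ := fun m => Fin (twoS m + 1)) n).commutes _).trans ?_)
    congr 1
    ring

theorem monodromy_fusible (u : ℂ) :
    Fusible (monodromy twoS η ξ K u) (monodromy twoS η ξ K (u - η)) := by
  rw [monodromy_eq, monodromy_eq]
  exact ((fusible_of_comm K).map (algebraMap ℂ (QOp twoS))).mul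
    (laxProd_fusible twoS η ξ (List.nodup_reverse.mpr (List.nodup_finRange N)) u)
    (entriesCommute_algebraMap _ K)

/-- The quantum determinant. -/
theorem qMinor_monodromy (u : ℂ) :
    qMinor (monodromy twoS η ξ K u) (monodromy twoS η ξ K (u - η)) 0 1 =
      (K.det * (aFun twoS η ξ u * dFun twoS η ξ (u - η))) • 1 := by
  have hL := List.nodup_reverse.mpr (List.nodup_finRange N)
  rw [monodromy_eq, monodromy_eq,
    qMinor_mul (laxProd_fusible twoS η ξ hL u) (entriesCommute_algebraMap _ K),
    qMinor_laxProd twoS η ξ hL, qMinor_map, ← map_mul, ← Algebra.algebraMap_eq_smul_one]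
  congr 2
  · rw [qMinor, Matrix.det_fin_two]
  · rw [aFun, dFun, ← Finset.prod_mul_distrib, List.map_reverse, List.prod_reverse,
      ← List.ofFn_eq_map, List.prod_ofFn]

theorem monodromyChain_fusible (l : ℕ) (u : ℂ) :
    FusibleChain (monodromyChain twoS η ξ K l u) := fun i j hij => by
  have h := monodromy_fusible twoS η ξ K (u + ((l : ℂ) - 1 - (i : ℕ)) * η)
  have e : u + ((l : ℂ) - 1 - (i : ℕ)) * η - η = u + ((l : ℂ) - 1 - (j : ℕ)) * η := by
    rw [hij]; push_cast; ring
  rwa [e] at h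

/-- The points decrease by `η` down to `u`, so removing the first matrix keeps the base point; hence
all terms of the fusion relation share the same `u`. -/
theorem tail_monodromyChain (l : ℕ) (u : ℂ) :
    Fin.tail (monodromyChain twoS η ξ K (l + 1) u) = monodromyChain twoS η ξ K l u := by
  funext i
  simp only [Fin.tail, monodromyChain, Fin.val_succ]
  congr 1
  push_cast
  ring

theorem fusedTransfer_zero (u : ℂ) : fusedTransfer twoS η ξ K 0 u = 1 := by
  rw [fusedTransfer_eq_symTrace _ _ _ _ (monodromyChain_fusible twoS η ξ K 0 u), symTrace_zero]

theorem fusedTransfer_one (u : ℂ) : fusedTransfer twoS η ξ K 1 u = transfer twoS η ξ K u := by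
  rw [fusedTransfer_eq_symTrace _ _ _ _ (monodromyChain_fusible twoS η ξ K 1 u), symTrace_one,
    transfer]
  simp [monodromyChain]

/-- The fusion relation of the transfer matrices. -/
theorem fusedTransfer_add_two (l : ℕ) (u : ℂ) :
    fusedTransfer twoS η ξ K (l + 2) u =
      transfer twoS η ξ K (u + ((l : ℂ) + 1) * η) * fusedTransfer twoS η ξ K (l + 1) u -
        (K.det * (aFun twoS η ξ (u + ((l : ℂ) + 1) * η) * dFun twoS η ξ (u + (l : ℂ) * η))) •
          fusedTransfer twoS η ξ K l u := by
  have h := monodromyChain_fusible twoS η ξ K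
  have h0 : monodromyChain twoS η ξ K (l + 2) u 0 =
      monodromy twoS η ξ K (u + ((l : ℂ) + 1) * η) := by
    simp only [monodromyChain]; congr 1; push_cast [Fin.val_zero]; ring
  have h1 : monodromyChain twoS η ξ K (l + 2) u 1 =
      monodromy twoS η ξ K (u + ((l : ℂ) + 1) * η - η) := by
    simp only [monodromyChain]; congr 1; push_cast [Fin.val_one]; ring
  rw [fusedTransfer_eq_symTrace _ _ _ _ (h _ u), fusedTransfer_eq_symTrace _ _ _ _ (h _ u),
    fusedTransfer_eq_symTrace _ _ _ _ (h _ u), (h _ u).symTrace_eq, h0, h1,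
    tail_monodromyChain, tail_monodromyChain, qMinor_monodromy, smul_mul_assoc, one_mul, transfer]
  congr 5
  ring

theorem fusedTransfer_commute_transfer (l : ℕ) (u v : ℂ) :
    Commute (fusedTransfer twoS η ξ K l u) (transfer twoS η ξ K v) := by
  induction l using Nat.twoStepInduction with
  | zero => rw [fusedTransfer_zero]; exact Commute.one_left _
  | one => rw [fusedTransfer_one]; exact transfer_commute twoS η ξ K u v
  | more l h0 h1 =>
    rw [fusedTransfer_add_two]
    exact ((transfer_commute twoS η ξ K _ v).mul_left h1).sub_left (h0.smul_left _)

/-- The fused transfer matrix of order `2 sₙ + 1` vanishes at `ξₙ^{(2sₙ)}`. -/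
theorem fusedTransfer_xiShift_eq_zero (n : Fin N) :
    fusedTransfer twoS η ξ K (twoS n + 1) (xiShift twoS η ξ n (twoS n)) = 0 := by
  rw [fusedTransfer_eq_symTrace _ _ _ _ (monodromyChain_fusible twoS η ξ K _ _)]
  refine symTrace_eq_zero fun y => ?_
  set w : Fin (twoS n + 1) → ℂ := fun i =>
    xiShift twoS η ξ n (twoS n) + (((twoS n + 1 : ℕ) : ℂ) - 1 - (i : ℕ)) * η with hw
  obtain ⟨L₁, L₂, hL⟩ := List.append_of_mem (a := n) (l := (List.finRange N).reverse) (by simp)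
  have hnd : (L₁ ++ n :: L₂).Nodup := hL ▸ List.nodup_reverse.mpr (List.nodup_finRange N)
  rw [List.nodup_append'] at hnd
  obtain ⟨hn1, hn2, hdis⟩ := hnd
  rw [List.nodup_cons] at hn2
  -- The Lax operator of site `n` is isolated. Its column words vanish, the part to its left
  -- preserves this because it is fusible, and the part to its right preserves it in any case.
  have hM : monodromyChain twoS η ξ K (twoS n + 1) (xiShift twoS η ξ n (twoS n)) = fun i =>
      (K.map (algebraMap ℂ (QOp twoS)) * laxProd twoS η ξ L₁ (w i)) *
        lax twoS η n (w i - ξ n) * laxProd twoS η ξ L₂ (w i) := by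
    funext i
    rw [monodromyChain, monodromy_eq, hL, laxProd_append, laxProd_cons]
    simp only [mul_assoc, hw]
  have hstep : ∀ i j : Fin (twoS n + 1), (j : ℕ) = i + 1 → w j = w i - η := fun i j hij => by
    simp only [hw, hij]; push_cast; ring
  rw [hM]
  refine colWord_mul_eq_zero_left (fun i j => ?_) (fun z => ?_) y
  · refine ((EntriesCommute.mul_right (entriesCommute_algebraMap _ K) ?_).mul_right ?_)
    · exact laxProd_entriesCommute twoS η ξ
        (fun a h2 h1 => hdis h1 (List.mem_cons_of_mem _ h2)) _ _
    · exact (laxProd_entriesCommute_lax twoS η ξ hn2.1 _ _).symm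
  · refine FusibleChain.colWord_mul_eq_zero (fun i j hij => ?_) (fun i j => ?_) (fun x => ?_) z
    · simp only [hstep i j hij]
      exact ((fusible_of_comm K).map (algebraMap ℂ (QOp twoS))).mul
        (laxProd_fusible twoS η ξ hn1 _) (entriesCommute_algebraMap _ K)
    · refine EntriesCommute.mul_right (entriesCommute_algebraMap _ K) ?_
      exact laxProd_entriesCommute_lax twoS η ξ (fun h => hdis h List.mem_cons_self) _ _
    · simp only [lax_eq_map]
      refine (colWord_map (onFactorHom (κ := fun m => Fin (twoS m + 1)) n).toRingHom
        (fun i => siteLax (twoS n) η (w i - ξ n)) x).trans ?_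
      rw [colWord_siteLax, Polynomial.map_zero]
      -- `w i - ξ n + η / 2 - sₙ η = -i η`: these are the degeneration points of `siteLax`.
      intro i
      simp only [hw, xiShift]
      push_cast
      ring

end Monodromy

/-! ### The action on a single factor and on the covectors. -/

section SeparationOfVariables

variable {N : ℕ} (twoS : Fin N → ℕ) (η : ℂ) (ξ : Fin N → ℂ) (K : Matrix (Fin 2) (Fin 2) ℂ)

/-- Only `a` has to commute with the factors, so the order in which the factors themselves are
multiplied plays no role. -/
theorem prod_ofFn_mul_right {R : Type*} [Ring R] {m : ℕ} (F : Fin m → R) (n : Fin m) (a : R)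
    (h : ∀ i, Commute (F i) a) :
    (List.ofFn F).prod * a = (List.ofFn (Function.update F n (F n * a))).prod := by
  induction m with
  | zero => exact n.elim0
  | succ m ih =>
    rw [List.ofFn_succ, List.ofFn_succ, List.prod_cons, List.prod_cons]
    induction n using Fin.cases with
    | zero =>
      have hc := (commute_prod_ofFn a (fun i => F i.succ) fun i => (h i.succ).symm).eq
      rw [mul_assoc, ← hc, ← mul_assoc]
      simp
    | succ n =>
      rw [mul_assoc, ih _ n fun i => h i.succ]
      congr 3
      funext i
      by_cases hi : i = n
      · subst hi; simp
      · simp [hi]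

theorem prod_ofFn_update_add_smul {R : Type*} [Ring R] [Algebra ℂ R] {m : ℕ} (F : Fin m → R)
    (n : Fin m) (p q : ℂ) (a b : R) :
    (List.ofFn (Function.update F n (p • a + q • b))).prod =
      p • (List.ofFn (Function.update F n a)).prod +
        q • (List.ofFn (Function.update F n b)).prod := by
  have := (MultilinearMap.mkPiAlgebraFin ℂ m R).map_update_add F n (p • a) (q • b)
  rw [MultilinearMap.map_update_smul, MultilinearMap.map_update_smul] at this
  simpa only [MultilinearMap.mkPiAlgebraFin_apply] using this

open scoped Classical in
/-- The factor of the site `n` in the covectors of the basis, set to zero when `h` is out of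
range. -/
noncomputable def truncFactor (k₂ : ℂ) (n : Fin N) (h : ℤ) : QOp twoS :=
  if 0 ≤ h ∧ h ≤ twoS n then sovFactor twoS η ξ K k₂ n h else 0

/-- A zero factor annihilates the product, so the truncation becomes a property of single factors
and boundary cases need no separate treatment for the covectors. -/
theorem sovCovector_eq (k₂ : ℂ) (S : Covector twoS) (h : Fin N → ℤ) :
    sovCovector twoS η ξ K k₂ S h =
      Matrix.vecMul S (List.ofFn fun n => truncFactor twoS η ξ K k₂ n (h n)).prod := by
  rw [sovCovector]
  split_ifs with hh
  · simp only [truncFactor, if_pos (hh _)]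
  · obtain ⟨n, hn⟩ := not_forall.mp hh
    have h0 : (0 : QOp twoS) ∈ List.ofFn fun n => truncFactor twoS η ξ K k₂ n (h n) :=
      (List.mem_ofFn' _ _).mpr ⟨n, by simp only [truncFactor, if_neg hn]⟩
    rw [List.prod_eq_zero h0, Matrix.vecMul_zero]

theorem truncFactor_commute (k₂ : ℂ) (n : Fin N) (h : ℤ) (u : ℂ) :
    Commute (truncFactor twoS η ξ K k₂ n h) (transfer twoS η ξ K u) := by
  rw [truncFactor]
  split_ifs
  · exact (fusedTransfer_commute_transfer twoS η ξ K _ _ _).smul_left _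
  · exact Commute.zero_left _

/-- The normalization of the factors, in terms of `l = 2 sₙ - h`. -/
noncomputable def sovCoeff (k₂ : ℂ) (n : Fin N) (l : ℕ) : ℂ :=
  k₂ ^ (-(l : ℤ)) / ∏ k ∈ Finset.range l, dFun twoS η ξ (xiShift twoS η ξ n ((twoS n : ℤ) - k))

theorem truncFactor_sub (k₂ : ℂ) (n : Fin N) {l : ℕ} (hl : l ≤ twoS n) :
    truncFactor twoS η ξ K k₂ n ((twoS n : ℤ) - l) =
      sovCoeff twoS η ξ k₂ n l • fusedTransfer twoS η ξ K l (xiShift twoS η ξ n (twoS n)) := by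
  have h1 : ((twoS n : ℤ) - ((twoS n : ℤ) - l)).toNat = l := by omega
  have h2 : (twoS n : ℤ) - l - twoS n = -l := by ring
  rw [truncFactor, if_pos (by omega), sovFactor, h1, h2, sovCoeff]

theorem sovCoeff_succ {k₂ : ℂ} (hk₂ : k₂ ≠ 0) {n : Fin N} {l : ℕ}
    (hd : dFun twoS η ξ (xiShift twoS η ξ n ((twoS n : ℤ) - l)) ≠ 0) :
    sovCoeff twoS η ξ k₂ n l =
      k₂ * dFun twoS η ξ (xiShift twoS η ξ n ((twoS n : ℤ) - l)) *
        sovCoeff twoS η ξ k₂ n (l + 1) := by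
  have h : k₂ ^ (-(l : ℤ)) = k₂ * k₂ ^ (-((l + 1 : ℕ) : ℤ)) := by
    rw [← zpow_one_add₀ hk₂]; congr 1; push_cast; ring
  rw [sovCoeff, sovCoeff, Finset.prod_range_succ, h]
  field_simp

theorem truncFactor_of_lt (k₂ : ℂ) {n : Fin N} {h : ℤ} (hh : h < 0 ∨ twoS n < h) :
    truncFactor twoS η ξ K k₂ n h = 0 := by
  rw [truncFactor, if_neg (by omega)]

/-- This is the `h - 1` term. For `l < 2sₙ` only the normalization changes; at `l = 2sₙ` both sides
vanish, the left by degeneration and the right by truncation. -/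
theorem smul_fusedTransfer_succ {k₂ : ℂ} (hk₂ : k₂ ≠ 0) {n : Fin N}
    (hd : ∀ k : ℤ, 1 ≤ k → k ≤ twoS n → dFun twoS η ξ (xiShift twoS η ξ n k) ≠ 0)
    {l : ℕ} (hl : l ≤ twoS n) :
    sovCoeff twoS η ξ k₂ n l •
        fusedTransfer twoS η ξ K (l + 1) (xiShift twoS η ξ n (twoS n)) =
      (k₂ * dFun twoS η ξ (xiShift twoS η ξ n ((twoS n : ℤ) - l))) •
        truncFactor twoS η ξ K k₂ n ((twoS n : ℤ) - l - 1) := by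
  rcases hl.eq_or_lt with rfl | hl
  · rw [fusedTransfer_xiShift_eq_zero, truncFactor_of_lt _ _ _ _ _ (by omega), smul_zero, smul_zero]
  · have e : (twoS n : ℤ) - l - 1 = (twoS n : ℤ) - (l + 1 : ℕ) := by push_cast; ring
    rw [e, truncFactor_sub _ _ _ _ _ _ hl, smul_smul,
      ← sovCoeff_succ _ _ _ hk₂ (hd _ (by omega) (by omega))]

/-- The fusion relation at `u = ξₙ^{(2sₙ)}`, solved for `T(u + lη) T^{(l)}(u)`; the factor `k₂ d` of
its determinant term is absorbed by the normalization, which leaves `k₁ a`. -/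
theorem truncFactor_mul_transfer {k₁ k₂ : ℂ} (hdet : K.det = k₁ * k₂) (hk₂ : k₂ ≠ 0) (n : Fin N)
    (hd : ∀ k : ℤ, 1 ≤ k → k ≤ twoS n → dFun twoS η ξ (xiShift twoS η ξ n k) ≠ 0)
    {h : ℤ} (h0 : 0 ≤ h) (h1 : h ≤ twoS n) :
    truncFactor twoS η ξ K k₂ n h * transfer twoS η ξ K (xiShift twoS η ξ n h) =
      (k₁ * aFun twoS η ξ (xiShift twoS η ξ n h)) • truncFactor twoS η ξ K k₂ n (h + 1) +
        (k₂ * dFun twoS η ξ (xiShift twoS η ξ n h)) • truncFactor twoS η ξ K k₂ n (h - 1) := by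
  obtain ⟨l, rfl⟩ : ∃ l : ℕ, h = (twoS n : ℤ) - l := ⟨((twoS n : ℤ) - h).toNat, by omega⟩
  have hl : l ≤ twoS n := by omega
  rw [truncFactor_sub _ _ _ _ _ _ hl, smul_mul_assoc,
    (fusedTransfer_commute_transfer twoS η ξ K _ _ _).eq,
    ← smul_fusedTransfer_succ twoS η ξ K hk₂ hd hl]
  cases l with
  -- Here `h = 2sₙ`: the term `h + 1` is truncated, and `T^{(0)} = 1` leaves `T = T^{(1)}`.
  | zero =>
    rw [truncFactor_of_lt _ _ _ _ _ (by omega), smul_zero, zero_add, fusedTransfer_zero, mul_one,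
      zero_add, fusedTransfer_one]
    simp
  | succ l =>
    have e1 : xiShift twoS η ξ n (twoS n) + ((l : ℂ) + 1) * η =
        xiShift twoS η ξ n ((twoS n : ℤ) - (l + 1 : ℕ)) := by
      simp only [xiShift]; push_cast; ring
    have e2 : xiShift twoS η ξ n (twoS n) + (l : ℂ) * η =
        xiShift twoS η ξ n ((twoS n : ℤ) - l) := by
      simp only [xiShift]; push_cast; ring
    have e3 : (twoS n : ℤ) - (l + 1 : ℕ) + 1 = (twoS n : ℤ) - l := by push_cast; ring
    rw [fusedTransfer_add_two, e1, e2, e3, truncFactor_sub _ _ _ _ _ _ (by omega : l ≤ twoS n),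
      sovCoeff_succ _ _ _ hk₂ (l := l) (hd _ (by omega) (by omega)), hdet]
    module

end SeparationOfVariables

end SpinChain

/-! ### The separate action of the transfer matrix. -/

open SpinChain

theorem proposition4p5 {N : ℕ} (twoS : Fin N → ℕ) (η : ℂ) (ξ : Fin N → ℂ)
    (K : Matrix (Fin 2) (Fin 2) ℂ) (k₁ k₂ : ℂ)
    (hK : K.charpoly =
      (Polynomial.X - Polynomial.C k₁) * (Polynomial.X - Polynomial.C k₂))
    (hk₂ : k₂ ≠ 0)
    (hd : ∀ (n : Fin N) (k : ℤ), 1 ≤ k → k ≤ twoS n →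
      dFun twoS η ξ (xiShift twoS η ξ n k) ≠ 0)
    (S : Covector twoS) (h : Fin N → ℤ) (hh : ∀ m, 0 ≤ h m ∧ h m ≤ twoS m) (n : Fin N) :
    Matrix.vecMul (sovCovector twoS η ξ K k₂ S h)
        (transfer twoS η ξ K (xiShift twoS η ξ n (h n))) =
      (k₁ * aFun twoS η ξ (xiShift twoS η ξ n (h n))) •
          sovCovector twoS η ξ K k₂ S (Function.update h n (h n + 1)) +
        (k₂ * dFun twoS η ξ (xiShift twoS η ξ n (h n))) •
          sovCovector twoS η ξ K k₂ S (Function.update h n (h n - 1)) := by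
  -- The determinant is the constant term of the characteristic polynomial, the sign being `(-1)^2`.
  have hdet : K.det = k₁ * k₂ := by
    rw [Matrix.det_eq_sign_charpoly_coeff, hK, Polynomial.coeff_zero_eq_eval_zero]
    simp
  have hu : ∀ j : ℤ, (fun m => truncFactor twoS η ξ K k₂ m (Function.update h n j m)) =
      Function.update (fun m => truncFactor twoS η ξ K k₂ m (h m)) n
        (truncFactor twoS η ξ K k₂ n j) := fun j =>
    funext fun m => Function.apply_update (fun m => truncFactor twoS η ξ K k₂ m) h n j m
  rw [sovCovector_eq, sovCovector_eq, sovCovector_eq, Matrix.vecMul_vecMul,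
    prod_ofFn_mul_right _ n _ fun m => truncFactor_commute twoS η ξ K k₂ m _ _,
    truncFactor_mul_transfer twoS η ξ K hdet hk₂ n (hd n) (hh n).1 (hh n).2,
    prod_ofFn_update_add_smul, hu, hu, Matrix.vecMul_add, Matrix.vecMul_smul, Matrix.vecMul_smul]
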